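/- Let $X$ be a connected weakly special cube complex, i.e. a connected non-positively curved cube complex in which no hyperplane self-intersects or self-osculates. (Two distinct edges $e_1,e_2$ at a vertex which are dual to the same hyperplane $H$ witness a self-intersection of $H$ if they form the corner of a square at that vertex, and a self-osculation otherwise; an edge with both ends at the same vertex also witnesses a self-osculation of its dual hyperplane.) Let $\widetilde X\to X$ be the universal cover, and let $G=\pi_1(X)$ act on the CAT(0) cube complex $\widetilde X$ by deck transformations. For a convex subcomplex $\widetilde Z\subset\widetilde X$ write $G_{\widetilde Z}$ for its stabilizer in $G$, and $\hat{\mathcal H}(\widetilde Z)$ for the set of hyperplanes of $\widetilde X$ that intersect $\widetilde Z$. Let $\widetilde A\subset\widetilde X$ be a convex subcomplex, $\tilde x\in\widetilde A$ a vertex, and let $\widetilde B$ be the orthogonal complement of $\widetilde A$ at $\tilde x$. That is, $\widetilde B$ is the convex subcomplex such that: (a) $\tilde x\in\widetilde B$; (b) $\widetilde B$ is orthogonal to $\widetilde A$: $\widetilde A\cap\widetilde B=\{\tilde x\}$, and every hyperplane in $\hat{\mathcal H}(\widetilde A)$ is distinct from and intersects every hyperplane in $\hat{\mathcal H}(\widetilde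 B)$; (c) the convex subcomplexes $\widetilde A'$ with $\hat{\mathcal H}(\widetilde A')=\hat{\mathcal H}(\widetilde A)$ are precisely the slices $\phi(\widetilde A\times\{\tilde b\})$ with $\tilde b$ a vertex of $\widetilde B$, where $\phi:\widetilde A\times\widetilde B\to\operatorname{Hull}(\widetilde A\cup\widetilde B)$ is the isomorphism of cube complexes onto the convex hull of $\widetilde A\cup\widetilde B$ that restricts to the identity maps $\widetilde A\times\{\tilde x\}\to\widetilde A$ and $\{\tilde x\}\times\widetilde B\to\widetilde B$. Then: 1. The natural map $\widetilde B/G_{\widetilde B}\to X$ is an embedding of cube complexes. 2. $G_{\widetilde A}$ and $G_{\widetilde B}$ commute: $gh=hg$ for all $g\in G_{\widetilde A}$ and $h\in G_{\widetilde B}$. 3. $G_{\widetilde A}$ and $G_{\widetilde B}$ both preserve the product subcomplex $\widetilde P_{\widetilde A}=\phi(\widetilde A\times\widetilde B)$. Moreover, $G_{\widetilde A}$ (resp. $G_{\widetilde B}$) acts on the $\widetilde A$ factor (resp. the $\widetilde B$ factor) in the natural way and acts trivially on the other factor: $g\,\phi(a,b)=\phi(ga,b)$ for $g\in G_{\widetilde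 A}$, and $h\,\phi(a,b)=\phi(a,hb)$ for $h\in G_{\widetilde B}$. -/

import Mathlib

universe u v w z

/-!
Cube complexes are encoded combinatorially.  The vertex set of the cube with set of directions `ι`
is `ι → Bool`.  A cube complex is recorded by its parametrised cubes, that is, its cubes together
with an identification of the cube with a standard one, and by the operation of passing to a
(reparametrised) face.
-/

/-- An isometric embedding of the standard cube `{0,1}^ι` onto a face of the standard cube
`{0,1}^κ`.  The direction `i` goes to the direction `dir i`, and the origin goes to the vertex
`off`.  For `ι = κ` finite these are exactly the symmetries of the cube. -/
@[ext]
structure CubeMap (ι κ : Type) where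
  dir : ι ↪ κ
  off : κ → Bool

namespace CubeMap

variable {ι κ μ ν : Type}

/-- The effect of a cube map on vertices. -/
noncomputable def apply (f : CubeMap ι κ) (v : ι → Bool) : κ → Bool :=
  fun k => xor (f.off k) (Function.extend f.dir v (fun _ => false) k)

protected def id (ι : Type) : CubeMap ι ι where
  dir := Function.Embedding.refl ι
  off := fun _ => false

/-- Composition of cube maps (first `f`, then `g`). -/
noncomputable def comp (g : CubeMap κ μ) (f : CubeMap ι κ) : CubeMap ι μ where
  dir := f.dir.trans g.dir
  off := g.apply f.off

theorem apply_dir (f : CubeMap ι κ) (v : ι → Bool) (i : ι) :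
    f.apply v (f.dir i) = xor (f.off (f.dir i)) (v i) := by
  simp [apply, f.dir.injective.extend_apply]

theorem apply_of_notMem (f : CubeMap ι κ) (v : ι → Bool) {k : κ} (hk : ¬ ∃ i, f.dir i = k) :
    f.apply v k = f.off k := by
  simp [apply, Function.extend_apply' _ _ _ hk]

theorem comp_apply (g : CubeMap κ μ) (f : CubeMap ι κ) (v : ι → Bool) :
    (g.comp f).apply v = g.apply (f.apply v) := by
  funext m
  by_cases hm : ∃ k, g.dir k = m
  · obtain ⟨k, rfl⟩ := hm
    rw [apply_dir]
    by_cases hk : ∃ i, f.dir i = k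
    · obtain ⟨i, rfl⟩ := hk
      have h := apply_dir (g.comp f) v i
      simp only [comp, Function.Embedding.trans_apply, apply_dir] at h ⊢
      rw [h, Bool.xor_assoc]
    · have : ¬ ∃ i, (g.comp f).dir i = g.dir k := by
        rintro ⟨i, hi⟩
        exact hk ⟨i, g.dir.injective hi⟩
      rw [apply_of_notMem _ _ this, apply_of_notMem _ _ hk]
      simp [comp, apply_dir]
  · have : ¬ ∃ i, (g.comp f).dir i = m := by
      rintro ⟨i, hi⟩
      exact hm ⟨f.dir i, hi⟩
    rw [apply_of_notMem _ _ this, apply_of_notMem _ _ hm]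
    simp [comp, apply_of_notMem _ _ hm]

/-- The vertex `v` of a cube, as a cube map from the cube of dimension zero. -/
def corner (v : ι → Bool) : CubeMap (Fin 0) ι where
  dir := ⟨fun i => i.elim0, fun i => i.elim0⟩
  off := v

/-- The edge of a cube that leaves the vertex `v` in the direction `i`. -/
def edge (v : ι → Bool) (i : ι) : CubeMap (Fin 1) ι where
  dir := ⟨fun _ => i, fun _ _ _ => Subsingleton.elim _ _⟩
  off := v

/-- The reflection of the one-dimensional cube. -/
def flip : CubeMap (Fin 1) (Fin 1) where
  dir := Function.Embedding.refl _
  off := fun _ => true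

/-- An embedding of sets of directions, with no reflections. -/
def ofEmbedding (d : ι ↪ κ) : CubeMap ι κ where
  dir := d
  off := fun _ => false

/-- The factor of a cube map that concerns the directions in `S`: a cube is the product of
`{0,1}^S` and `{0,1}^(Sᶜ)`, and a face of it is the product of a face of each factor. -/
def restrict (f : CubeMap ι κ) (S : Set κ) : CubeMap (f.dir ⁻¹' S : Set ι) S where
  dir := ⟨fun i => ⟨f.dir i, i.2⟩, fun _ _ h =>
    Subtype.ext (f.dir.injective (congrArg Subtype.val h))⟩
  off := fun k => f.off k

theorem restrict_apply (f : CubeMap ι κ) (S : Set κ) (v : ι → Bool) (k : S) :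
    (f.restrict S).apply (fun i => v i) k = f.apply v k := by
  by_cases hk : ∃ i, f.dir i = k
  · obtain ⟨i, hi⟩ := hk
    obtain ⟨k, hkS⟩ := k
    simp only at hi
    subst hi
    have h := apply_dir (f.restrict S) (fun i => v i) ⟨i, hkS⟩
    rw [apply_dir]
    exact h
  · have : ¬ ∃ i, (f.restrict S).dir i = k := by
      rintro ⟨i, hi⟩
      exact hk ⟨i, congrArg Subtype.val hi⟩
    rw [apply_of_notMem _ _ this, apply_of_notMem _ _ hk]
    rfl

theorem restrict_id (S : Set ι) : (CubeMap.id ι).restrict S = CubeMap.id S := rfl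

theorem restrict_comp (g : CubeMap κ μ) (f : CubeMap ι κ) (S : Set μ) :
    (g.comp f).restrict S = (g.restrict S).comp (f.restrict (g.dir ⁻¹' S)) := by
  refine CubeMap.ext rfl ?_
  funext k
  exact (restrict_apply g S f.off k).symm

end CubeMap

/-- A cube complex: a complex obtained by gluing cubes along faces by isometries.
`cubes ι` is the set of parametrised cubes with set of directions `ι` (so an honest cube of
dimension `n` is an orbit of `n! * 2 ^ n` elements of `cubes (Fin n)`), and `map f σ` is the face
`f` of `σ`, with its parametrisation.  All cubes are finite dimensional, and the symmetries of the
standard cube act freely on parametrisations (no cube is folded). There is no other restriction: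
several faces of a cube may be glued together, the dimension may be unbounded and the complex need
not be locally finite. -/
structure CubeComplex where
  cubes : Type → Type u
  map : ∀ {ι κ : Type}, CubeMap ι κ → cubes κ → cubes ι
  map_id : ∀ {ι : Type} (σ : cubes ι), map (CubeMap.id ι) σ = σ
  map_comp : ∀ {ι κ μ : Type} (g : CubeMap κ μ) (f : CubeMap ι κ) (σ : cubes μ),
    map (g.comp f) σ = map f (map g σ)
  finite : ∀ {ι : Type}, cubes ι → Finite ι
  free : ∀ {ι : Type} (f : CubeMap ι ι) (σ : cubes ι), map f σ = σ → f = CubeMap.id ι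

namespace CubeComplex

/-! ### Vertices, edges, squares, paths -/

abbrev Vertex (X : CubeComplex.{u}) : Type u := X.cubes (Fin 0)

/-- Edges with an orientation. -/
abbrev Edge (X : CubeComplex.{u}) : Type u := X.cubes (Fin 1)

abbrev Square (X : CubeComplex.{u}) : Type u := X.cubes (Fin 2)

section Basic

variable (X : CubeComplex.{u})

/-- The vertex of the parametrised cube `σ` at the corner `v`. -/
def corner {ι : Type} (σ : X.cubes ι) (v : ι → Bool) : X.Vertex := X.map (CubeMap.corner v) σ

/-- The edge of `σ` leaving the corner `v` in direction `i`, oriented away from the corner `v`. -/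
def side {ι : Type} (σ : X.cubes ι) (v : ι → Bool) (i : ι) : X.Edge := X.map (CubeMap.edge v i) σ

/-- The vertex of a parametrised cube at the origin. -/
def base {ι : Type} (σ : X.cubes ι) : X.Vertex := X.corner σ (fun _ => false)

/-- The edges of a parametrised cube that leave the origin. -/
def baseEdge {ι : Type} (σ : X.cubes ι) (i : ι) : X.Edge := X.side σ (fun _ => false) i

def src (e : X.Edge) : X.Vertex := X.corner e (fun _ => false)

def tgt (e : X.Edge) : X.Vertex := X.corner e (fun _ => true)

/-- The same edge with the opposite orientation. -/
def rev (e : X.Edge) : X.Edge := X.map CubeMap.flip e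

/-- `X.IsEdgePath x l y`: the list of oriented edges `l` is an edge path from `x` to `y`. -/
def IsEdgePath : X.Vertex → List X.Edge → X.Vertex → Prop
  | x, [], y => x = y
  | x, e :: l, y => X.src e = x ∧ IsEdgePath (X.tgt e) l y

/-- Nonempty and path-connected. -/
def IsConnected : Prop :=
  Nonempty X.Vertex ∧ ∀ x y : X.Vertex, ∃ l, X.IsEdgePath x l y

/-- The moves that generate homotopy of edge paths: deleting a backtrack and pushing a path
across a square. -/
inductive HomotopyMove : List X.Edge → List X.Edge → Prop
  | backtrack (l m : List X.Edge) (e : X.Edge) :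
      HomotopyMove (l ++ e :: X.rev e :: m) (l ++ m)
  | square (l m : List X.Edge) (s : X.Square) :
      HomotopyMove
        (l ++ X.side s ![false, false] 0 :: X.side s ![true, false] 1 :: m)
        (l ++ X.side s ![false, false] 1 :: X.side s ![false, true] 0 :: m)

/-- Homotopy, with fixed endpoints, of edge paths from `x` to `y`. -/
def Homotopic (x y : X.Vertex) : List X.Edge → List X.Edge → Prop :=
  Relation.EqvGen fun l m => X.IsEdgePath x l y ∧ X.IsEdgePath x m y ∧ X.HomotopyMove l m

def IsSimplyConnected : Prop :=
  X.IsConnected ∧ ∀ (x : X.Vertex) (l : List X.Edge), X.IsEdgePath x l x → X.Homotopic x x l []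

/-- A shortest edge path from `x` to `y` (a geodesic of the combinatorial metric). -/
def IsGeodesic (x : X.Vertex) (l : List X.Edge) (y : X.Vertex) : Prop :=
  X.IsEdgePath x l y ∧ ∀ m, X.IsEdgePath x m y → l.length ≤ m.length

/-! ### Non-positive curvature -/

/-- Two oriented edges form the corner of a square at their common initial vertex. -/
def FormCorner (e f : X.Edge) : Prop :=
  ∃ s : X.Square, X.baseEdge s 0 = e ∧ X.baseEdge s 1 = f

/-- Every vertex link is a flag simplicial complex.  The vertices of the link of `x` are the
oriented edges leaving `x`, and its simplices are the corners at `x` of cubes.  The first two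
clauses say that the link is simplicial: a simplex has distinct vertices and is determined by them.
The last clause says that it is flag. -/
structure IsNonPositivelyCurved : Prop where
  baseEdge_injective : ∀ {ι : Type} (σ : X.cubes ι), Function.Injective (X.baseEdge σ)
  eq_of_baseEdge_eq : ∀ {ι : Type} (σ τ : X.cubes ι), X.base σ = X.base τ →
    (∀ i, X.baseEdge σ i = X.baseEdge τ i) → σ = τ
  exists_cube : ∀ {ι : Type} [Finite ι] (x : X.Vertex) (e : ι → X.Edge),
    (∀ i, X.src (e i) = x) → (∀ i j, i ≠ j → X.FormCorner (e i) (e j)) →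
      ∃ σ : X.cubes ι, X.base σ = x ∧ ∀ i, X.baseEdge σ i = e i

/-! ### Hyperplanes -/

/-- Elementary parallelism: opposite edges of a square.  An edge is also
identified with its reverse, as hyperplanes concern unoriented edges. -/
def ElemParallel (e f : X.Edge) : Prop :=
  f = X.rev e ∨ ∃ s : X.Square, X.side s ![false, false] 0 = e ∧ X.side s ![false, true] 0 = f

/-- A hyperplane, given as the class of all edges dual to it: a parallelism class of edges. -/
def Hyperplane : Type u := Quot X.ElemParallel

/-- The hyperplane dual to an edge. -/
def hyp (e : X.Edge) : X.Hyperplane := Quot.mk _ e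

/-- Two oriented edges have different underlying edges. -/
def DistinctEdges (e f : X.Edge) : Prop := e ≠ f ∧ e ≠ X.rev f

/-- The two hyperplanes intersect at `(x; e, f)` for some `x`, `e`, `f`. -/
def HypIntersect (H K : X.Hyperplane) : Prop :=
  ∃ e f : X.Edge, X.src e = X.src f ∧ X.DistinctEdges e f ∧ X.FormCorner e f ∧
    X.hyp e = H ∧ X.hyp f = K

def SelfIntersects (H : X.Hyperplane) : Prop := X.HypIntersect H H

/-- Either two distinct edges dual to `H` leave a common vertex and do not form the corner of a
square there, or some edge dual to `H` has both its ends at the same vertex. -/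
def SelfOsculates (H : X.Hyperplane) : Prop :=
  (∃ e f : X.Edge, X.src e = X.src f ∧ X.DistinctEdges e f ∧ ¬ X.FormCorner e f ∧
    X.hyp e = H ∧ X.hyp f = H) ∨
  ∃ e : X.Edge, X.src e = X.tgt e ∧ X.hyp e = H

structure IsWeaklySpecial : Prop where
  nonPositivelyCurved : X.IsNonPositivelyCurved
  not_selfIntersects : ∀ H : X.Hyperplane, ¬ X.SelfIntersects H
  not_selfOsculates : ∀ H : X.Hyperplane, ¬ X.SelfOsculates H

/-- Distinct hyperplanes with non-empty intersection. -/
def Transverse (H K : X.Hyperplane) : Prop := H ≠ K ∧ X.HypIntersect H K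

end Basic

/-! ### Combinatorial maps and coverings -/

/-- A combinatorial map of cube complexes (each open cube is mapped isometrically to a cube). -/
structure Hom (X : CubeComplex.{u}) (Y : CubeComplex.{v}) where
  app : ∀ {ι : Type}, X.cubes ι → Y.cubes ι
  app_map : ∀ {ι κ : Type} (f : CubeMap ι κ) (σ : X.cubes κ), app (X.map f σ) = Y.map f (app σ)

namespace Hom

protected def id (X : CubeComplex.{u}) : Hom X X where
  app := fun σ => σ
  app_map := fun _ _ => rfl

def comp {X : CubeComplex.{u}} {Y : CubeComplex.{v}} {Z : CubeComplex.{w}}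
    (g : Hom Y Z) (f : Hom X Y) : Hom X Z where
  app := fun σ => g.app (f.app σ)
  app_map := fun h σ => by rw [f.app_map, g.app_map]

/-- An embedding of cube complexes: distinct cubes have distinct images. -/
def IsEmbedding {X : CubeComplex.{u}} {Y : CubeComplex.{v}} (f : Hom X Y) : Prop :=
  ∀ ι : Type, Function.Injective (fun σ : X.cubes ι => f.app σ)

/-- A covering: every cube of the target lifts uniquely through every lift of its base vertex.
(As all parametrisations of a cube are considered, the same holds for all its vertices.) -/
def IsCovering {Y : CubeComplex.{v}} {X : CubeComplex.{u}} (p : Hom Y X) : Prop :=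
  ∀ {ι : Type} (σ : X.cubes ι) (y : Y.Vertex), p.app y = X.base σ →
    ∃! τ : Y.cubes ι, p.app τ = σ ∧ Y.base τ = y

structure IsUniversalCover {Y : CubeComplex.{v}} {X : CubeComplex.{u}} (p : Hom Y X) : Prop where
  isCovering : p.IsCovering
  isSimplyConnected : Y.IsSimplyConnected

end Hom

/-- The group of deck transformations of `p : Y → X`.  If `p` is the universal cover, this is
the fundamental group of `X`, with its action on `Y`. -/
def deckGroup {Y : CubeComplex.{v}} {X : CubeComplex.{u}} (p : Hom Y X) :
    Subgroup (∀ ι : Type, Equiv.Perm (Y.cubes ι)) where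
  carrier := {g | (∀ {ι κ : Type} (f : CubeMap ι κ) (σ : Y.cubes κ),
      g ι (Y.map f σ) = Y.map f (g κ σ)) ∧
    ∀ {ι : Type} (σ : Y.cubes ι), p.app (g ι σ) = p.app σ}
  one_mem' := ⟨fun _ _ => rfl, fun _ => rfl⟩
  mul_mem' := by
    rintro g h ⟨hg, hg'⟩ ⟨hh, hh'⟩
    refine ⟨fun f σ => ?_, fun σ => ?_⟩
    · simp only [Pi.mul_apply, Equiv.Perm.mul_apply]
      rw [hh, hg]
    · simp only [Pi.mul_apply, Equiv.Perm.mul_apply]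
      rw [hg', hh']
  inv_mem' := by
    rintro g ⟨hg, hg'⟩
    refine ⟨fun {ι κ} f σ => ?_, fun {ι} σ => ?_⟩
    · refine (g ι).symm_apply_eq.mpr ?_
      rw [hg]
      exact congrArg _ ((g κ).apply_symm_apply σ).symm
    · have h := hg' ((g ι).symm σ)
      rw [Equiv.apply_symm_apply] at h
      exact h.symm

/-- A deck transformation as a combinatorial map. -/
def deckHom {Y : CubeComplex.{v}} {X : CubeComplex.{u}} {p : Hom Y X} (g : deckGroup p) :
    Hom Y Y where
  app := fun {ι} σ => g.1 ι σ
  app_map := fun f σ => g.2.1 f σ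

/-! ### Subcomplexes -/

structure Subcomplex (X : CubeComplex.{u}) where
  carrier : ∀ ι : Type, Set (X.cubes ι)
  map_mem : ∀ {ι κ : Type} (f : CubeMap ι κ) {σ : X.cubes κ},
    σ ∈ carrier κ → X.map f σ ∈ carrier ι

/-- The range of a combinatorial map. -/
def Hom.range {X : CubeComplex.{u}} {Y : CubeComplex.{v}} (f : Hom X Y) : Subcomplex Y where
  carrier := fun _ => {τ | ∃ σ, f.app σ = τ}
  map_mem := by
    rintro ι κ h _ ⟨σ, rfl⟩
    exact ⟨X.map h σ, f.app_map h σ⟩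

namespace Subcomplex

section

variable {X : CubeComplex.{u}}

instance : LE (Subcomplex X) := ⟨fun A B => ∀ ι, A.carrier ι ⊆ B.carrier ι⟩

/-- A subcomplex as a cube complex in its own right. -/
def toComplex (A : Subcomplex X) : CubeComplex.{u} where
  cubes := fun ι => A.carrier ι
  map := fun f σ => ⟨X.map f σ.1, A.map_mem f σ.2⟩
  map_id := fun σ => Subtype.ext (X.map_id σ.1)
  map_comp := fun g f σ => Subtype.ext (X.map_comp g f σ.1)
  finite := fun σ => X.finite σ.1
  free := fun f σ h => X.free f σ.1 (congrArg Subtype.val h)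

/-- The inclusion of a subcomplex. -/
def incl (A : Subcomplex X) : Hom A.toComplex X where
  app := fun σ => σ.1
  app_map := fun _ _ => rfl

/-- The union of two subcomplexes. -/
def union (A B : Subcomplex X) : Subcomplex X where
  carrier := fun ι => A.carrier ι ∪ B.carrier ι
  map_mem := fun f _ h => h.imp (A.map_mem f) (B.map_mem f)

/-- The link of each vertex of `A` in `A` is a full subcomplex of its link in `X`: a cube of `X`
based at a vertex of `A` belongs to `A` as soon as all its edges at this vertex do. -/
def IsLocallyConvex (A : Subcomplex X) : Prop :=
  ∀ {ι : Type} (σ : X.cubes ι), X.base σ ∈ A.carrier (Fin 0) →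
    (∀ i, X.baseEdge σ i ∈ A.carrier (Fin 1)) → σ ∈ A.carrier ι

/-- A convex subcomplex of a CAT(0) cube complex: a non-empty locally convex subcomplex that
is convex in the combinatorial metric, that is, contains every geodesic edge path between any two
of its vertices. -/
structure IsConvex (A : Subcomplex X) : Prop where
  nonempty : (A.carrier (Fin 0)).Nonempty
  isLocallyConvex : A.IsLocallyConvex
  geodesic_mem : ∀ x ∈ A.carrier (Fin 0), ∀ y ∈ A.carrier (Fin 0), ∀ l, X.IsGeodesic x l y →
    ∀ e ∈ l, e ∈ A.carrier (Fin 1)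

/-- The convex hull: the intersection of all convex subcomplexes that contain `S`. -/
def hull (S : Subcomplex X) : Subcomplex X where
  carrier := fun ι => {σ | ∀ C : Subcomplex X, C.IsConvex → S ≤ C → σ ∈ C.carrier ι}
  map_mem := fun f _ h C hC hS => C.map_mem f (h C hC hS)

/-- The set of hyperplanes of `X` that intersect `A`. -/
def hyperplanes (A : Subcomplex X) : Set X.Hyperplane :=
  {H | ∃ e ∈ A.carrier (Fin 1), X.hyp e = H}

/-- Two (convex) subcomplexes are parallel if they are crossed by the same hyperplanes. -/
def Parallel (A B : Subcomplex X) : Prop := A.hyperplanes = B.hyperplanes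

/-- Two (convex) subcomplexes are orthogonal if their intersection is a single vertex, and every
hyperplane intersecting `A` is transverse to every hyperplane intersecting `B`. -/
structure Orthogonal (A B : Subcomplex X) : Prop where
  exists_vertex : ∃ x : X.Vertex, ∀ y : X.Vertex,
    (y ∈ A.carrier (Fin 0) ∧ y ∈ B.carrier (Fin 0)) ↔ y = x
  isEmpty : ∀ {ι : Type} (σ : X.cubes ι), σ ∈ A.carrier ι → σ ∈ B.carrier ι → IsEmpty ι
  transverse : ∀ H ∈ A.hyperplanes, ∀ K ∈ B.hyperplanes, X.Transverse H K

end

end Subcomplex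

/-! ### Products -/

/-- A parametrised cube of a product of cube complexes: the directions are split into two
sets, and there is a cube in each factor. -/
@[ext]
structure ProdCube (X : CubeComplex.{u}) (Y : CubeComplex.{v}) (ι : Type) where
  S : Set ι
  fst : X.cubes S
  snd : Y.cubes (Sᶜ : Set ι)

theorem ProdCube.restrict_eq_id {X : CubeComplex.{u}} {ι : Type} {S T : Set ι} (hST : T = S)
    (f : CubeMap T S) (σ : X.cubes S) (h : HEq (X.map f σ) σ) :
    (∀ i : T, (f.dir i : ι) = i) ∧ ∀ k : S, f.off k = false := by
  subst hST
  have := X.free f σ (eq_of_heq h)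
  subst this
  exact ⟨fun _ => rfl, fun _ => rfl⟩

/-- The product of two cube complexes. -/
def prod (X : CubeComplex.{u}) (Y : CubeComplex.{v}) : CubeComplex.{max u v} where
  cubes := fun ι => ProdCube X Y ι
  map := fun f c => ⟨f.dir ⁻¹' c.S, X.map (f.restrict c.S) c.fst, Y.map (f.restrict c.Sᶜ) c.snd⟩
  map_id := by
    rintro ι ⟨S, σ, τ⟩
    have h1 := X.map_id σ
    have h2 := Y.map_id τ
    simp only [CubeMap.restrict_id, ProdCube.mk.injEq]
    exact ⟨rfl, heq_of_eq h1, heq_of_eq h2⟩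
  map_comp := by
    rintro ι κ μ g f ⟨S, σ, τ⟩
    have h1 := X.map_comp (g.restrict S) (f.restrict (g.dir ⁻¹' S)) σ
    have h2 := Y.map_comp (g.restrict Sᶜ) (f.restrict (g.dir ⁻¹' Sᶜ)) τ
    simp only [CubeMap.restrict_comp, ProdCube.mk.injEq]
    exact ⟨rfl, heq_of_eq h1, heq_of_eq h2⟩
  finite := by
    rintro ι ⟨S, σ, τ⟩
    have h1 := X.finite σ
    have h2 := Y.finite τ
    have h3 := (Set.toFinite S).union (Set.toFinite Sᶜ)
    rw [Set.union_compl_self] at h3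
    exact Set.finite_univ_iff.mp h3
  free := by
    rintro ι f ⟨S, σ, τ⟩ h
    simp only [ProdCube.mk.injEq] at h
    obtain ⟨hS, h1, h2⟩ := h
    have hS' : (f.dir ⁻¹' Sᶜ : Set ι) = Sᶜ := by rw [Set.preimage_compl, hS]
    obtain ⟨a1, b1⟩ := ProdCube.restrict_eq_id hS _ _ h1
    obtain ⟨a2, b2⟩ := ProdCube.restrict_eq_id hS' _ _ h2
    have hd : ∀ i, f.dir i = i := by
      intro i
      by_cases hi : i ∈ f.dir ⁻¹' S
      · exact a1 ⟨i, hi⟩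
      · exact a2 ⟨i, hi⟩
    have ho : ∀ k, f.off k = false := by
      intro k
      by_cases hk : k ∈ S
      · exact b1 ⟨k, hk⟩
      · exact b2 ⟨k, hk⟩
    exact CubeMap.ext (Function.Embedding.ext hd) (funext ho)

/-- The product of two combinatorial maps. -/
def Hom.prodMap {X : CubeComplex.{u}} {Y : CubeComplex.{v}} {X' : CubeComplex.{w}}
    {Y' : CubeComplex.{z}} (f : Hom X X') (g : Hom Y Y') : Hom (X.prod Y) (X'.prod Y') where
  app := fun c => ⟨c.S, f.app c.fst, g.app c.snd⟩
  app_map := by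
    rintro ι κ h ⟨S, σ, τ⟩
    have h1 := f.app_map (h.restrict S) σ
    have h2 := g.app_map (h.restrict Sᶜ) τ
    exact ProdCube.ext rfl (heq_of_eq h1) (heq_of_eq h2)

theorem univ_square {ι κ : Type} (f : CubeMap ι κ) (S : Set κ) (hS : S = Set.univ) :
    (CubeMap.ofEmbedding (Function.Embedding.subtype (· ∈ S))).comp (f.restrict S) =
      f.comp (CubeMap.ofEmbedding (Function.Embedding.subtype (· ∈ f.dir ⁻¹' S))) := by
  refine CubeMap.ext rfl (funext fun k => ?_)
  have hk : k ∈ S := hS ▸ Set.mem_univ k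
  have h1 := CubeMap.apply_dir (CubeMap.ofEmbedding (Function.Embedding.subtype (· ∈ S)))
    (f.restrict S).off ⟨k, hk⟩
  have h2 : f.apply (fun _ => false) k = f.off k := by
    by_cases h : ∃ i, f.dir i = k
    · obtain ⟨i, rfl⟩ := h
      simp [CubeMap.apply_dir]
    · exact CubeMap.apply_of_notMem _ _ h
  refine Eq.trans h1 (Eq.trans ?_ h2.symm)
  simp [CubeMap.ofEmbedding, CubeMap.restrict]

/-- A map from a cube with no directions to the standard vertex. -/
def CubeMap.ofIsEmpty (ι : Type) [IsEmpty ι] : CubeMap ι (Fin 0) where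
  dir := Function.Embedding.ofIsEmpty
  off := fun _ => false

theorem isEmpty_coe {ι : Type} {S : Set ι} (hS : ∀ i, i ∉ S) : IsEmpty S :=
  ⟨fun i => hS i.1 i.2⟩

instance isEmpty_compl_univ {ι : Type} : IsEmpty ((Set.univ : Set ι)ᶜ : Set ι) :=
  isEmpty_coe fun i hi => hi (Set.mem_univ i)

instance isEmpty_compl_empty_compl {ι : Type} : IsEmpty (∅ : Set ι) :=
  isEmpty_coe fun _ hi => hi

/-- The slice inclusion `X → X × {y} ⊆ X × Y`. -/
def sliceLeft (X : CubeComplex.{u}) {Y : CubeComplex.{v}} (y : Y.Vertex) : Hom X (X.prod Y) where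
  app := fun {ι} σ => ⟨Set.univ,
    X.map (CubeMap.ofEmbedding (Function.Embedding.subtype (· ∈ Set.univ))) σ,
    Y.map (CubeMap.ofIsEmpty ((Set.univ : Set ι)ᶜ : Set ι)) y⟩
  app_map := by
    intro ι κ f σ
    have h1 := congrArg (fun h => X.map h σ) (univ_square f Set.univ rfl)
    simp only [X.map_comp] at h1
    have h2 : (CubeMap.ofIsEmpty ((Set.univ : Set κ)ᶜ : Set κ)).comp
        (f.restrict (Set.univ : Set κ)ᶜ) = CubeMap.ofIsEmpty ((Set.univ : Set ι)ᶜ : Set ι) :=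
      CubeMap.ext (Function.Embedding.ext fun i => (isEmpty_compl_univ.false i).elim)
        (funext fun k => k.elim0)
    have h3 := congrArg (fun h => Y.map h y) h2
    simp only [Y.map_comp] at h3
    simp only [prod, ProdCube.mk.injEq]
    exact ⟨rfl, heq_of_eq h1.symm, heq_of_eq h3.symm⟩

/-- The slice inclusion `Y → {x} × Y ⊆ X × Y`. -/
def sliceRight {X : CubeComplex.{u}} (Y : CubeComplex.{v}) (x : X.Vertex) : Hom Y (X.prod Y) where
  app := fun {ι} τ => ⟨∅,
    X.map (CubeMap.ofIsEmpty (∅ : Set ι)) x,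
    Y.map (CubeMap.ofEmbedding (Function.Embedding.subtype (· ∈ (∅ : Set ι)ᶜ))) τ⟩
  app_map := by
    intro ι κ f τ
    have h1 := congrArg (fun h => Y.map h τ) (univ_square f (∅ : Set κ)ᶜ Set.compl_empty)
    simp only [Y.map_comp] at h1
    have h2 : (CubeMap.ofIsEmpty (∅ : Set κ)).comp
        (f.restrict (∅ : Set κ)) = CubeMap.ofIsEmpty (∅ : Set ι) :=
      CubeMap.ext (Function.Embedding.ext fun i => (isEmpty_compl_empty_compl.false i).elim)
        (funext fun k => k.elim0)
    have h3 := congrArg (fun h => X.map h x) h2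
    simp only [X.map_comp] at h3
    simp only [prod, ProdCube.mk.injEq]
    exact ⟨rfl, heq_of_eq h3.symm, heq_of_eq h1.symm⟩

namespace Subcomplex

/-! ### Orthogonal complements -/

section

variable {X : CubeComplex.{u}}

/-- `φ` is an isomorphism from `A × B` onto the convex hull of `A ∪ B` whose restrictions
`A × {x} → A` and `{x} × B → B` are induced by the identity maps. -/
structure IsProductIso (A B : Subcomplex X) {x : X.Vertex} (hxA : x ∈ A.carrier (Fin 0))
    (hxB : x ∈ B.carrier (Fin 0)) (φ : Hom (A.toComplex.prod B.toComplex) X) : Prop where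
  isEmbedding : φ.IsEmbedding
  range_eq : φ.range = (A.union B).hull
  left : ∀ {ι : Type} (σ : A.toComplex.cubes ι),
    φ.app ((sliceLeft A.toComplex (Y := B.toComplex) ⟨x, hxB⟩).app σ) = σ.1
  right : ∀ {ι : Type} (τ : B.toComplex.cubes ι),
    φ.app ((sliceRight (X := A.toComplex) B.toComplex ⟨x, hxA⟩).app τ) = τ.1

/-- The slice `φ (A × {b})`. -/
def slice {A B : Subcomplex X} (φ : Hom (A.toComplex.prod B.toComplex) X)
    (b : B.toComplex.Vertex) : Subcomplex X :=
  (φ.comp (sliceLeft A.toComplex b)).range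

/-- `B` is the orthogonal complement of the convex subcomplex `A` at the vertex `x ∈ A`: a
convex subcomplex through `x`, orthogonal to `A`, such that the convex subcomplexes
parallel to `A` are precisely the slices `φ (A × {b})`, for `b` a vertex of `B` and `φ` the
isomorphism from `A × B` onto the convex hull of `A ∪ B`. -/
structure IsOrthogonalComplement (A : Subcomplex X) {x : X.Vertex}
    (hxA : x ∈ A.carrier (Fin 0)) (B : Subcomplex X) : Prop where
  isConvex : B.IsConvex
  mem : x ∈ B.carrier (Fin 0)
  orthogonal : B.Orthogonal A
  parallel_iff : ∃ φ : Hom (A.toComplex.prod B.toComplex) X, IsProductIso A B hxA mem φ ∧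
    ∀ A' : Subcomplex X, (A'.IsConvex ∧ A'.Parallel A) ↔
      ∃ b : B.toComplex.Vertex, A' = slice φ b

end

/-! ### Stabilisers and quotients -/

section

variable {Y : CubeComplex.{v}} {X : CubeComplex.{u}}

/-- The stabiliser of `A` in the group of deck transformations: all `g` with `g A = A`. -/
def stab (p : Hom Y X) (A : Subcomplex Y) : Subgroup (deckGroup p) where
  carrier := {g | ∀ {ι : Type} (σ : Y.cubes ι), g.1 ι σ ∈ A.carrier ι ↔ σ ∈ A.carrier ι}
  one_mem' := fun _ => Iff.rfl
  mul_mem' := by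
    intro g h hg hh ι σ
    exact (hg (h.1 ι σ)).trans (hh σ)
  inv_mem' := by
    intro g hg ι σ
    have h := hg ((g.1 ι).symm σ)
    rw [Equiv.apply_symm_apply] at h
    exact h.symm

/-- The natural action on `A` of an element of the stabiliser of `A`. -/
def stabHom {p : Hom Y X} (A : Subcomplex Y) (g : stab p A) : Hom A.toComplex A.toComplex where
  app := fun {ι} σ => ⟨(deckHom g.1).app σ.1, (g.2 σ.1).mpr σ.2⟩
  app_map := fun f σ => Subtype.ext ((deckHom g.1).app_map f σ.1)

/-- Two cubes of `A` are in the same orbit of the stabiliser of `A`. -/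
def SameOrbit (p : Hom Y X) (A : Subcomplex Y) (ι : Type) (σ τ : A.toComplex.cubes ι) : Prop :=
  ∃ g : stab p A, (stabHom A g).app σ = τ

/-- The map on orbits induced by the restriction of `p` to `A`. -/
def orbitMap (p : Hom Y X) (A : Subcomplex Y) (ι : Type) :
    Quot (SameOrbit p A ι) → X.cubes ι :=
  Quot.lift (fun σ => p.app σ.1) (by
    rintro σ _ ⟨g, rfl⟩
    exact (g.1.2.2 σ.1).symm)

/-- The quotient of `A` by its stabiliser. -/
def quotient (p : Hom Y X) (A : Subcomplex Y) : CubeComplex.{v} where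
  cubes := fun ι => Quot (SameOrbit p A ι)
  map := fun f => Quot.map (A.toComplex.map f) (by
    rintro σ _ ⟨g, rfl⟩
    exact ⟨g, (stabHom A g).app_map f σ⟩)
  map_id := by
    rintro ι ⟨σ⟩
    exact congrArg (Quot.mk _) (A.toComplex.map_id σ)
  map_comp := by
    rintro ι κ μ g f ⟨σ⟩
    exact congrArg (Quot.mk _) (A.toComplex.map_comp g f σ)
  finite := by
    rintro ι ⟨σ⟩
    exact A.toComplex.finite σ
  free := by
    rintro ι f ⟨σ⟩ h
    have h' : p.app (Y.map f σ.1) = p.app σ.1 := congrArg (orbitMap p A ι) h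
    rw [p.app_map] at h'
    exact X.free f _ h'

/-- The natural map from the quotient of `A` by its stabiliser to `X`. -/
def quotientHom (p : Hom Y X) (A : Subcomplex Y) : Hom (quotient p A) X where
  app := fun {ι} => orbitMap p A ι
  app_map := by
    rintro ι κ f ⟨σ⟩
    exact p.app_map f σ.1

end

end Subcomplex

end CubeComplex

/-!
In a weakly special complex `X` an oriented edge is determined by its origin and its hyperplane:
two edges with common origin and hyperplane would witness a self-intersection or a
self-osculation. Consequently two maps from a connected complex to the universal cover `Y` agree
as soon as they agree at one vertex and send every edge to edges over the same hyperplane of `X`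
(`CubeComplex.Hom.app_eq_of_hyp_eq`).

In the product subcomplex `φ (A × B)`, the edges `φ (a, b)` for a fixed edge `a` of `A` are all
dual to the hyperplane of `a`, and similarly for edges of `B`; and deck transformations
preserve hyperplanes of `X`. For `g` in the stabiliser of `A`, the maps `g ∘ φ` and
`φ ∘ (g × id)` agree at the base vertex, so they are equal; the same holds for the stabiliser of `B`
(`IsProductIso.deckHom_app`). The two stabilisers commute since deck transformations that
agree at a vertex are equal (`deck_ext`).

For the embedding, let two cubes of `B` have the same image in `X`. A deck transformation `g` maps
one to the other (`Hom.IsUniversalCover.exists_deck`), and it remains to see that `g` stabilises `B`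
(`mem_stab_of_vertex`). By the same rigidity principle, `g` maps the slice of `A` at a vertex `b` of
`B` identically to the slice at `g b`, if both vertices are in `B`. Hence the set of hyperplanes of
`A` is invariant under `g`, and `g` permutes the convex subcomplexes parallel to `A`, which are the
slices. So the edges of `B` at `b` are mapped into the product subcomplex, and in fact to edges of
`B`, because the edges of the slice at `g b` are the images of those of the slice at `b`.
Connectedness and local convexity of `B` do the rest.
-/

/-! ### Combinatorial maps and edge paths -/

namespace CubeComplex

section Paths

variable {X : CubeComplex.{u}} {Y : CubeComplex.{v}}

theorem Hom.app_src (F : Hom X Y) (e : X.Edge) : F.app (X.src e) = Y.src (F.app e) :=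
  F.app_map _ _

theorem Hom.app_tgt (F : Hom X Y) (e : X.Edge) : F.app (X.tgt e) = Y.tgt (F.app e) :=
  F.app_map _ _

theorem Hom.app_base (F : Hom X Y) {ι : Type} (σ : X.cubes ι) :
    F.app (X.base σ) = Y.base (F.app σ) :=
  F.app_map _ _

theorem base_map {ι κ : Type} (f : CubeMap ι κ) (σ : X.cubes κ) :
    X.base (X.map f σ) = X.corner σ f.off := by
  unfold base corner
  rw [← X.map_comp]
  congr 1
  refine CubeMap.ext (Function.Embedding.ext fun i => i.elim0) (funext fun k => ?_)
  by_cases h : ∃ i, f.dir i = k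
  · obtain ⟨i, rfl⟩ := h
    exact (f.apply_dir _ i).trans (Bool.xor_false _)
  · exact f.apply_of_notMem _ h

theorem src_map {κ : Type} (f : CubeMap (Fin 1) κ) (σ : X.cubes κ) :
    X.src (X.map f σ) = X.corner σ f.off :=
  base_map f σ

theorem src_side {ι : Type} (σ : X.cubes ι) (v : ι → Bool) (i : ι) :
    X.src (X.side σ v i) = X.corner σ v :=
  src_map _ _

theorem tgt_side {ι : Type} [DecidableEq ι] (σ : X.cubes ι) (v : ι → Bool) (i : ι) :
    X.tgt (X.side σ v i) = X.corner σ (Function.update v i (!v i)) := by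
  unfold tgt side corner
  rw [← X.map_comp]
  congr 1
  refine CubeMap.ext (Function.Embedding.ext fun i => i.elim0) (funext fun k => ?_)
  by_cases h : i = k
  · subst h
    refine ((CubeMap.edge v i).apply_dir (fun _ => true) 0).trans ?_
    simp only [CubeMap.edge, CubeMap.corner, Bool.xor_true, Function.update_self]
    rfl
  · refine ((CubeMap.edge v i).apply_of_notMem (fun _ => true) ?_).trans ?_
    · rintro ⟨_, hi⟩
      exact h hi
    · simp [CubeMap.edge, CubeMap.corner, Function.update_of_ne (Ne.symm h)]

theorem src_rev (e : X.Edge) : X.src (X.rev e) = X.tgt e :=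
  src_map _ _

theorem rev_rev (e : X.Edge) : X.rev (X.rev e) = e := by
  unfold rev
  rw [← X.map_comp]
  conv_rhs => rw [← X.map_id e]
  congr 1
  refine CubeMap.ext rfl (funext fun k => ?_)
  exact (CubeMap.flip.apply_dir (fun _ => true) k).trans (by simp [CubeMap.flip, CubeMap.id])

theorem tgt_rev (e : X.Edge) : X.tgt (X.rev e) = X.src e := by
  rw [← src_rev, rev_rev]

theorem IsEdgePath.map (F : Hom X Y) {l : List X.Edge} {x y : X.Vertex}
    (h : X.IsEdgePath x l y) : Y.IsEdgePath (F.app x) (l.map F.app) (F.app y) := by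
  induction l generalizing x with
  | nil => exact congrArg F.app h
  | cons e l ih =>
    refine ⟨(F.app_src e).symm.trans (congrArg F.app h.1), ?_⟩
    have := ih h.2
    rwa [F.app_tgt] at this

theorem isEdgePath_append {l m : List X.Edge} {x z : X.Vertex} :
    X.IsEdgePath x (l ++ m) z ↔ ∃ y, X.IsEdgePath x l y ∧ X.IsEdgePath y m z := by
  induction l generalizing x with
  | nil => exact ⟨fun h => ⟨x, rfl, h⟩, by rintro ⟨_, rfl, h⟩; exact h⟩
  | cons e l ih =>
    simp only [List.cons_append, IsEdgePath, ih]
    exact ⟨fun ⟨h, y, h1, h2⟩ => ⟨y, ⟨h, h1⟩, h2⟩, fun ⟨y, ⟨h, h1⟩, h2⟩ => ⟨h, y, h1, h2⟩⟩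

theorem IsEdgePath.end_eq {l : List X.Edge} {x y z : X.Vertex}
    (h : X.IsEdgePath x l y) (h' : X.IsEdgePath x l z) : y = z := by
  induction l generalizing x with
  | nil => exact h.symm.trans h'
  | cons e l ih => exact ih h.2 h'.2

/-- A property of vertices that spreads along edges spreads along edge paths. -/
theorem IsEdgePath.rec_vertex {P : X.Vertex → Prop} {l : List X.Edge} {x y : X.Vertex}
    (h : X.IsEdgePath x l y) (hx : P x) (hP : ∀ e ∈ l, P (X.src e) → P (X.tgt e)) : P y := by
  induction l generalizing x with
  | nil => exact (show x = y from h) ▸ hx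
  | cons e l ih =>
    exact ih h.2 (hP e (by simp) (h.1.symm ▸ hx)) fun f hf => hP f (List.mem_cons_of_mem _ hf)

theorem IsConnected.rec_vertex (hX : X.IsConnected) {P : X.Vertex → Prop} {x : X.Vertex}
    (hx : P x) (hP : ∀ e, P (X.src e) → P (X.tgt e)) (y : X.Vertex) : P y := by
  obtain ⟨l, hl⟩ := hX.2 x y
  exact hl.rec_vertex hx fun e _ => hP e

theorem exists_isGeodesic (hX : X.IsConnected) (x y : X.Vertex) : ∃ l, X.IsGeodesic x l y := by
  classical
  have h : ∃ n, ∃ l, X.IsEdgePath x l y ∧ l.length = n := by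
    obtain ⟨l, hl⟩ := hX.2 x y
    exact ⟨_, l, hl, rfl⟩
  obtain ⟨l, hl, hn⟩ := Nat.find_spec h
  exact ⟨l, hl, fun m hm => hn ▸ Nat.find_min' h ⟨m, hm, rfl⟩⟩

theorem Hom.elemParallel (F : Hom X Y) {e f : X.Edge} (h : X.ElemParallel e f) :
    Y.ElemParallel (F.app e) (F.app f) := by
  rcases h with rfl | ⟨s, rfl, rfl⟩
  · exact Or.inl (F.app_map _ _)
  · exact Or.inr ⟨F.app s, (F.app_map _ _).symm, (F.app_map _ _).symm⟩

/-- The map on hyperplanes induced by a combinatorial map. -/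
def Hom.hypMap (F : Hom X Y) : X.Hyperplane → Y.Hyperplane :=
  Quot.map F.app fun _ _ h => F.elemParallel h

theorem Hom.hyp_app (F : Hom X Y) (e : X.Edge) : Y.hyp (F.app e) = F.hypMap (X.hyp e) := rfl

theorem Hom.hyp_congr (F : Hom X Y) {e f : X.Edge} (h : X.hyp e = X.hyp f) :
    Y.hyp (F.app e) = Y.hyp (F.app f) :=
  congrArg F.hypMap h

theorem hyp_side_zero (s : X.Square) :
    X.hyp (X.side s ![false, false] 0) = X.hyp (X.side s ![false, true] 0) :=
  Quot.sound (Or.inr ⟨s, rfl, rfl⟩)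

end Paths

/-! ### Rigidity of maps to coverings of weakly special complexes -/

section Rigidity

variable {X : CubeComplex.{u}} {Y : CubeComplex.{v}} {Z : CubeComplex.{w}}

theorem IsWeaklySpecial.src_ne_tgt (hX : X.IsWeaklySpecial) (e : X.Edge) : X.src e ≠ X.tgt e :=
  fun h => hX.not_selfOsculates _ (Or.inr ⟨e, h, rfl⟩)

/-- In a weakly special complex, an oriented edge is determined by its origin and its
hyperplane. -/
theorem IsWeaklySpecial.edge_ext (hX : X.IsWeaklySpecial) {e f : X.Edge}
    (hs : X.src e = X.src f) (hh : X.hyp e = X.hyp f) : e = f := by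
  by_contra hne
  have hd : X.DistinctEdges e f := by
    refine ⟨hne, ?_⟩
    rintro rfl
    rw [src_rev] at hs
    exact hX.src_ne_tgt f hs.symm
  by_cases hc : X.FormCorner e f
  · exact hX.not_selfIntersects _ ⟨e, f, hs, hd, hc, rfl, hh.symm⟩
  · exact hX.not_selfOsculates _ (Or.inl ⟨e, f, hs, hd, hc, rfl, hh.symm⟩)

theorem Hom.IsCovering.eq_of_base_eq {p : Hom Y X} (hp : p.IsCovering) {ι : Type}
    {σ τ : Y.cubes ι} (h : p.app σ = p.app τ) (hb : Y.base σ = Y.base τ) : σ = τ :=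
  (hp (p.app τ) (Y.base τ) (p.app_base τ)).unique ⟨h, hb⟩ ⟨rfl, rfl⟩

/-- Two maps from a connected complex to a covering `Y` of a weakly special complex `X` are equal
as soon as they agree at a vertex and send each edge to edges over the same hyperplane of `X`:
along an edge path, weak speciality propagates the agreement, and cubes of `X` are determined by
their edges at a vertex. -/
theorem Hom.app_eq_of_hyp_eq (hX : X.IsWeaklySpecial) {p : Hom Y X} (hp : p.IsCovering)
    (hZ : Z.IsConnected) (F F' : Hom Z Y) {z : Z.Vertex} (hz : F.app z = F'.app z)
    (hF : ∀ e : Z.Edge, X.hyp (p.app (F.app e)) = X.hyp (p.app (F'.app e)))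
    {ι : Type} (σ : Z.cubes ι) : F.app σ = F'.app σ := by
  have hedge : ∀ e : Z.Edge, F.app (Z.src e) = F'.app (Z.src e) → F.app e = F'.app e := by
    intro e he
    rw [F.app_src, F'.app_src] at he
    refine hp.eq_of_base_eq (hX.edge_ext ?_ (hF e)) he
    rw [← p.app_src, ← p.app_src, he]
  have hvert : ∀ y : Z.Vertex, F.app y = F'.app y := by
    refine hZ.rec_vertex hz fun e he => ?_
    rw [F.app_tgt, F'.app_tgt, hedge e he]
  have hbase : Y.base (F.app σ) = Y.base (F'.app σ) := by
    rw [← F.app_base, ← F'.app_base, hvert]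
  refine hp.eq_of_base_eq (hX.nonPositivelyCurved.eq_of_baseEdge_eq _ _ ?_ fun i => ?_) hbase
  · rw [← p.app_base, ← p.app_base, hbase]
  · have h := congrArg p.app (hedge (Z.baseEdge σ i) (hvert _))
    calc X.baseEdge (p.app (F.app σ)) i = p.app (F.app (Z.baseEdge σ i)) := by
          unfold baseEdge side; rw [F.app_map, p.app_map]
      _ = p.app (F'.app (Z.baseEdge σ i)) := h
      _ = X.baseEdge (p.app (F'.app σ)) i := by
          unfold baseEdge side; rw [F'.app_map, p.app_map]

end Rigidity

end CubeComplex

/-! ### Transitivity of deck transformations on fibres -/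

namespace CubeComplex

section Lifting

variable {X : CubeComplex.{u}} {Y : CubeComplex.{v}}

/-- The set of endpoints of those edge paths that start at `z` and have the same projection as `l`.
For a covering it has at most one element. -/
def liftEnds (p : Hom Y X) (l : List Y.Edge) (z : Y.Vertex) : Set Y.Vertex :=
  {w | ∃ m, Y.IsEdgePath z m w ∧ m.map p.app = l.map p.app}

theorem Hom.IsCovering.list_ext {p : Hom Y X} (hp : p.IsCovering) {l m : List Y.Edge}
    {x y z : Y.Vertex} (hl : Y.IsEdgePath x l y) (hm : Y.IsEdgePath x m z)
    (h : l.map p.app = m.map p.app) : l = m := by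
  induction l generalizing x m with
  | nil => simpa using h
  | cons e l ih =>
    cases m with
    | nil => simp at h
    | cons f m =>
      simp only [List.map_cons, List.cons.injEq] at h
      obtain rfl : e = f := hp.eq_of_base_eq h.1 (hl.1.trans hm.1.symm)
      rw [ih hl.2 hm.2 h.2]

theorem Hom.IsCovering.liftEnds_unique {p : Hom Y X} (hp : p.IsCovering) {l : List Y.Edge}
    {z w w' : Y.Vertex} (h : w ∈ liftEnds p l z) (h' : w' ∈ liftEnds p l z) : w = w' := by
  obtain ⟨m, hm, h1⟩ := h
  obtain ⟨m', hm', h2⟩ := h'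
  obtain rfl := hp.list_ext hm hm' (h1.trans h2.symm)
  exact hm.end_eq hm'

theorem Hom.IsCovering.liftEnds_nonempty {p : Hom Y X} (hp : p.IsCovering) {l : List Y.Edge}
    {x y z : Y.Vertex} (hl : Y.IsEdgePath x l y) (hz : p.app z = p.app x) :
    ∃ w, w ∈ liftEnds p l z := by
  induction l generalizing x z with
  | nil => exact ⟨z, [], rfl, rfl⟩
  | cons e l ih =>
    obtain ⟨f, ⟨hf, hfz⟩, -⟩ := hp (p.app e) z (by rw [hz, ← hl.1]; exact p.app_base e)
    have ht : p.app (Y.tgt f) = p.app (Y.tgt e) := by rw [p.app_tgt, hf, p.app_tgt]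
    obtain ⟨w, m, hm, hml⟩ := ih hl.2 ht
    exact ⟨w, f :: m, ⟨hfz, hm⟩, by simp [hf, hml]⟩

theorem app_eq_of_mem_liftEnds {p : Hom Y X} {l : List Y.Edge} {x y z w : Y.Vertex}
    (hl : Y.IsEdgePath x l y) (hz : p.app z = p.app x) (hw : w ∈ liftEnds p l z) :
    p.app w = p.app y := by
  obtain ⟨m, hm, h⟩ := hw
  have h1 := hm.map p
  rw [h, hz] at h1
  exact h1.end_eq (hl.map p)

theorem mem_liftEnds_append {p : Hom Y X} {l m : List Y.Edge} {z w : Y.Vertex} :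
    w ∈ liftEnds p (l ++ m) z ↔ ∃ y ∈ liftEnds p l z, w ∈ liftEnds p m y := by
  constructor
  · rintro ⟨k, hk, h⟩
    rw [List.map_append, List.map_eq_append_iff] at h
    obtain ⟨l', m', rfl, hl, hm⟩ := h
    obtain ⟨y, hy, hy'⟩ := isEdgePath_append.mp hk
    exact ⟨y, ⟨l', hy, hl⟩, m', hy', hm⟩
  · rintro ⟨y, ⟨l', hy, hl⟩, m', hy', hm⟩
    exact ⟨l' ++ m', isEdgePath_append.mpr ⟨y, hy, hy'⟩, by simp [hl, hm]⟩

/-- Replacing a subpath by another one does not change the endpoints of lifts, if the two subpaths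
have lifts with common endpoints from every starting point. -/
theorem Hom.IsCovering.liftEnds_congr_middle {p : Hom Y X} (hp : p.IsCovering)
    {l a b m : List Y.Edge} {x y z : Y.Vertex} (hl : Y.IsEdgePath x (l ++ (a ++ m)) y)
    (hz : p.app z = p.app x)
    (hab : ∀ u v, Y.IsEdgePath u (a ++ m) y → p.app v = p.app u →
      ∃ w, w ∈ liftEnds p a v ∧ w ∈ liftEnds p b v) :
    liftEnds p (l ++ (a ++ m)) z = liftEnds p (l ++ (b ++ m)) z := by
  obtain ⟨u, hu, hum⟩ := isEdgePath_append.mp hl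
  ext t
  simp only [mem_liftEnds_append]
  refine exists_congr fun v => and_congr_right fun hv => ?_
  obtain ⟨w, hwa, hwb⟩ := hab u v hum (app_eq_of_mem_liftEnds hu hz hv)
  constructor
  · rintro ⟨w', hw', h⟩
    exact ⟨w, hwb, hp.liftEnds_unique hwa hw' ▸ h⟩
  · rintro ⟨w', hw', h⟩
    exact ⟨w, hwa, hp.liftEnds_unique hwb hw' ▸ h⟩

theorem Hom.IsCovering.liftEnds_eq_of_move {p : Hom Y X} (hp : p.IsCovering)
    {l m : List Y.Edge} {x y z : Y.Vertex} (hl : Y.IsEdgePath x l y) (hz : p.app z = p.app x)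
    (h : Y.HomotopyMove l m) : liftEnds p l z = liftEnds p m z := by
  cases h with
  | backtrack l m e =>
    refine hp.liftEnds_congr_middle (a := [e, Y.rev e]) (b := []) hl hz fun u v hu hv => ?_
    obtain ⟨f, ⟨hf, hfv⟩, -⟩ := hp (p.app e) v (by rw [hv, ← hu.1]; exact p.app_base e)
    refine ⟨v, ⟨[f, Y.rev f], ⟨hfv, src_rev f, ?_⟩, ?_⟩, [], rfl, rfl⟩
    · exact (tgt_rev f).trans hfv
    · have : p.app (Y.rev f) = p.app (Y.rev e) := by
        unfold rev; rw [p.app_map, p.app_map, hf]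
      simp [hf, this]
  | square l m s =>
    refine hp.liftEnds_congr_middle
      (a := [Y.side s ![false, false] 0, Y.side s ![true, false] 1])
      (b := [Y.side s ![false, false] 1, Y.side s ![false, true] 0]) hl hz fun u v hu hv => ?_
    have h0 : (![false, false] : Fin 2 → Bool) = fun _ => false := by decide
    have hu' : Y.base s = u := by
      rw [← hu.1, src_side, h0]; rfl
    obtain ⟨t, ⟨ht, htv⟩, -⟩ := hp (p.app s) v (by rw [hv, ← hu']; exact p.app_base s)
    have hside : ∀ c i, p.app (Y.side t c i) = p.app (Y.side s c i) := by
      intro c i; unfold side; rw [p.app_map, p.app_map, ht]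
    refine ⟨Y.corner t ![true, true],
      ⟨[Y.side t ![false, false] 0, Y.side t ![true, false] 1], ⟨?_, ?_, ?_⟩, by simp [hside]⟩,
      ⟨[Y.side t ![false, false] 1, Y.side t ![false, true] 0], ⟨?_, ?_, ?_⟩, by simp [hside]⟩⟩
    · rw [src_side, h0]; exact htv
    · rw [src_side, tgt_side]; congr 1; decide
    · change Y.tgt _ = _
      rw [tgt_side]; congr 1; decide
    · rw [src_side, h0]; exact htv
    · rw [src_side, tgt_side]; congr 1; decide
    · change Y.tgt _ = _
      rw [tgt_side]; congr 1; decide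

theorem Hom.IsCovering.liftEnds_eq_of_homotopic {p : Hom Y X} (hp : p.IsCovering)
    {l m : List Y.Edge} {x y z : Y.Vertex} (hz : p.app z = p.app x) (h : Y.Homotopic x y l m) :
    liftEnds p l z = liftEnds p m z := by
  induction h with
  | rel l m h => exact hp.liftEnds_eq_of_move h.1 hz h.2.2
  | refl => rfl
  | symm _ _ _ ih => exact ih.symm
  | trans _ _ _ _ _ ih ih' => exact ih.trans ih'

theorem IsEdgePath.reverse {l : List Y.Edge} {x y : Y.Vertex} (h : Y.IsEdgePath x l y) :
    Y.IsEdgePath y (l.reverse.map Y.rev) x := by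
  induction l generalizing x with
  | nil => exact (show x = y from h).symm
  | cons e l ih =>
    rw [List.reverse_cons, List.map_append]
    exact isEdgePath_append.mpr ⟨_, ih h.2, src_rev e, (tgt_rev e).trans h.1⟩

/-- Monodromy is trivial over a simply connected covering space: lifts of two paths with common
endpoints have a common endpoint. -/
theorem Hom.IsUniversalCover.liftEnds_unique {p : Hom Y X} (hp : p.IsUniversalCover)
    {l l' : List Y.Edge} {x y z w w' : Y.Vertex} (hl : Y.IsEdgePath x l y)
    (hl' : Y.IsEdgePath x l' y) (hz : p.app z = p.app x) (hw : w ∈ liftEnds p l z)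
    (hw' : w' ∈ liftEnds p l' z) : w = w' := by
  have hc : p.IsCovering := hp.isCovering
  have hloop := isEdgePath_append.mpr ⟨y, hl, hl'.reverse⟩
  have hends := hc.liftEnds_eq_of_homotopic hz (hp.isSimplyConnected.2 x _ hloop)
  obtain ⟨t, ht⟩ := hc.liftEnds_nonempty hl'.reverse
    (app_eq_of_mem_liftEnds hl hz hw)
  have htz : t = z := by
    have h1 : t ∈ liftEnds p [] z := hends ▸ mem_liftEnds_append.mpr ⟨w, hw, ht⟩
    exact hc.liftEnds_unique h1 ⟨[], rfl, rfl⟩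
  subst htz
  obtain ⟨m, hm, hml⟩ := ht
  refine hc.liftEnds_unique ⟨_, hm.reverse, ?_⟩ hw'
  have hrev : p.app ∘ Y.rev = X.rev ∘ p.app := funext fun e => p.app_map _ _
  have h2 : m.reverse.map p.app = l'.map (X.rev ∘ p.app) := by
    rw [List.map_reverse, hml, List.map_map, List.map_reverse, List.reverse_reverse, hrev]
  rw [List.map_map, hrev, ← List.map_map, h2, List.map_map]
  exact List.map_congr_left fun e _ => rev_rev _

/-- The graph of a finite-dimensional cube is connected. -/
theorem cube_vertex_induction {ι : Type} [Finite ι] [DecidableEq ι] {P : (ι → Bool) → Prop}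
    (h0 : P fun _ => false) (h : ∀ v i, P v → P (Function.update v i (!v i))) (v : ι → Bool) :
    P v := by
  have := Fintype.ofFinite ι
  have key : ∀ s : Finset ι, P fun i => decide (i ∈ s) := by
    intro s
    induction s using Finset.induction_on with
    | empty => simpa using h0
    | insert a s ha ih =>
      convert h _ a ih using 1
      funext i
      by_cases hi : i = a
      · subst hi; simp [ha]
      · simp [hi]
  simpa using key (Finset.univ.filter fun i => v i = true)

theorem base_vertex (x : Y.Vertex) : Y.base x = x := by
  conv_rhs => rw [← Y.map_id x]
  unfold base corner
  congr 1
  exact CubeMap.ext (Function.Embedding.ext fun i => i.elim0) rfl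

/-- A universal covering `p : Y → X` lifts along itself, with a prescribed value at a vertex. -/
theorem Hom.IsUniversalCover.exists_lift {p : Hom Y X} (hp : p.IsUniversalCover) {x z : Y.Vertex}
    (hz : p.app z = p.app x) :
    ∃ F : Hom Y Y, F.app x = z ∧ ∀ {ι : Type} (σ : Y.cubes ι), p.app (F.app σ) = p.app σ := by
  classical
  have hc : p.IsCovering := hp.isCovering
  have hex : ∀ y, ∃ w, ∃ l, Y.IsEdgePath x l y ∧ w ∈ liftEnds p l z := by
    intro y
    obtain ⟨l, hl⟩ := hp.isSimplyConnected.1.2 x y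
    obtain ⟨w, hw⟩ := hc.liftEnds_nonempty hl hz
    exact ⟨w, l, hl, hw⟩
  -- `V` is the lift on vertices, obtained by lifting a chosen path `L y` from `x` to `y`.
  choose V L hL hV using hex
  have hVeq : ∀ {y w l}, Y.IsEdgePath x l y → w ∈ liftEnds p l z → V y = w := fun hl hw =>
    hp.liftEnds_unique (hL _) hl hz (hV _) hw
  have hpV : ∀ y, p.app (V y) = p.app y := fun y => app_eq_of_mem_liftEnds (hL y) hz (hV y)
  have hVedge : ∀ e f : Y.Edge, p.app e = p.app f → Y.src f = V (Y.src e) →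
      Y.tgt f = V (Y.tgt e) := by
    intro e f hef hs
    refine (hVeq (l := L (Y.src e) ++ [e]) (isEdgePath_append.mpr ⟨_, hL (Y.src e), ⟨rfl, rfl⟩⟩)
      (mem_liftEnds_append.mpr ⟨_, hV _, [f], ⟨hs, rfl⟩, ?_⟩)).symm
    simp [hef]
  have hcube : ∀ {ι : Type} (σ : Y.cubes ι), ∃ τ : Y.cubes ι, p.app τ = p.app σ ∧
      Y.base τ = V (Y.base σ) := fun σ =>
    (hc (p.app σ) (V (Y.base σ)) (by rw [hpV, p.app_base])).exists
  -- `F σ` is the cube over `p σ` at the prescribed base vertex; it is compatible with faces because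
  -- its other corners are the prescribed ones as well.
  choose F hpF hbF using @hcube
  have hcorner : ∀ {ι : Type} (σ : Y.cubes ι) (v : ι → Bool),
      Y.corner (F σ) v = V (Y.corner σ v) := by
    intro ι σ v
    have := Y.finite σ
    refine cube_vertex_induction (P := fun v => Y.corner (F σ) v = V (Y.corner σ v))
      (hbF σ) (fun v i hv => ?_) v
    rw [← src_side _ _ i, ← src_side _ _ i] at hv
    rw [← tgt_side, ← tgt_side]
    refine hVedge _ _ ?_ hv
    unfold side
    rw [p.app_map, p.app_map, hpF]
  refine ⟨⟨fun σ => F σ, fun f σ => ?_⟩, ?_, fun σ => hpF σ⟩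
  · refine hc.eq_of_base_eq ?_ ?_
    · rw [hpF, p.app_map, p.app_map, hpF]
    · rw [hbF, base_map, base_map, hcorner]
  · have h := hbF x
    rw [base_vertex, base_vertex] at h
    exact h.trans (hVeq (l := []) rfl ⟨[], rfl, rfl⟩)

/-- The deck group of a universal covering acts transitively on the fibres over vertices. -/
theorem Hom.IsUniversalCover.exists_deck (hX : X.IsWeaklySpecial) {p : Hom Y X}
    (hp : p.IsUniversalCover) {x z : Y.Vertex} (hz : p.app x = p.app z) :
    ∃ g : deckGroup p, (deckHom g).app x = z := by
  obtain ⟨F, hF, hpF⟩ := hp.exists_lift hz.symm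
  obtain ⟨F', hF', hpF'⟩ := hp.exists_lift hz
  have hconn := hp.isSimplyConnected.1
  refine ⟨⟨fun ι => ⟨fun σ => F.app σ, fun σ => F'.app σ, fun σ => ?_, fun σ => ?_⟩,
    fun f σ => F.app_map f σ, fun σ => hpF σ⟩, hF⟩
  · refine Hom.app_eq_of_hyp_eq hX hp.isCovering hconn (F'.comp F) (Hom.id Y) (z := x) ?_ ?_ σ
    · exact (congrArg F'.app hF).trans hF'
    · intro e
      exact congrArg X.hyp ((hpF' _).trans (hpF e))
  · refine Hom.app_eq_of_hyp_eq hX hp.isCovering hconn (F.comp F') (Hom.id Y) (z := z) ?_ ?_ σ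
    · exact (congrArg F.app hF').trans hF
    · intro e
      exact congrArg X.hyp ((hpF _).trans (hpF' e))

end Lifting

end CubeComplex

/-! ### Products -/

namespace CubeComplex

section Products

variable {X : CubeComplex.{u}} {Y : CubeComplex.{v}} {X' : CubeComplex.{w}} {Y' : CubeComplex.{z}}

/-- Equality of cubes of a product, without heterogeneous equalities. -/
theorem ProdCube.ext_of_map {ι : Type} {c d : ProdCube X Y ι} (h : c.S = d.S)
    (h1 : X.map (CubeMap.ofEmbedding (Set.embeddingOfSubset d.S c.S h.ge)) c.fst = d.fst)
    (h2 : Y.map (CubeMap.ofEmbedding (Set.embeddingOfSubset d.Sᶜ c.Sᶜ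
      (Set.compl_subset_compl.mpr h.le))) c.snd = d.snd) : c = d := by
  obtain ⟨S, σ, τ⟩ := c
  obtain ⟨T, σ', τ'⟩ := d
  obtain rfl : S = T := h
  exact ProdCube.ext rfl (heq_of_eq ((X.map_id σ).symm.trans h1))
    (heq_of_eq ((Y.map_id τ).symm.trans h2))

theorem _root_.CubeMap.comp_off_of_false {ι κ μ : Type} (g : CubeMap κ μ) (f : CubeMap ι κ)
    (h : ∀ k, f.off k = false) : (g.comp f).off = g.off := by
  funext m
  change g.apply f.off m = _
  by_cases hm : ∃ k, g.dir k = m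
  · obtain ⟨k, rfl⟩ := hm
    rw [CubeMap.apply_dir, h, Bool.xor_false]
  · exact g.apply_of_notMem _ hm

theorem exists_eq_sliceLeft {ι : Type} (c : (X.prod Y).cubes ι) (h : c.S = Set.univ) :
    ∃ (σ : X.cubes ι) (y : Y.Vertex), (sliceLeft X y).app σ = c := by
  obtain ⟨S, σ, τ⟩ := c
  obtain rfl : S = Set.univ := h
  refine ⟨X.map (CubeMap.ofEmbedding (Equiv.Set.univ ι).symm.toEmbedding) σ,
    Y.map (CubeMap.corner fun _ => false) τ, ProdCube.ext rfl (heq_of_eq ?_) (heq_of_eq ?_)⟩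
  · refine (X.map_comp _ _ _).symm.trans (Eq.trans ?_ (X.map_id σ))
    congr 1
    exact CubeMap.ext rfl (CubeMap.comp_off_of_false _ _ fun _ => rfl)
  · refine (Y.map_comp _ _ _).symm.trans (Eq.trans ?_ (Y.map_id τ))
    congr 1
    exact CubeMap.ext (Function.Embedding.ext fun i => (isEmpty_compl_univ.false i).elim)
      (funext fun i => (isEmpty_compl_univ.false i).elim)

theorem exists_eq_sliceRight {ι : Type} (c : (X.prod Y).cubes ι) (h : c.S = ∅) :
    ∃ (x : X.Vertex) (τ : Y.cubes ι), (sliceRight Y x).app τ = c := by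
  obtain ⟨S, σ, τ⟩ := c
  obtain rfl : S = ∅ := h
  refine ⟨X.map (CubeMap.corner fun _ => false) σ,
    Y.map (CubeMap.ofEmbedding ⟨fun i => (⟨i, fun h => h⟩ : ((∅ : Set ι)ᶜ : Set ι)),
      fun _ _ h => congrArg Subtype.val h⟩) τ, ProdCube.ext rfl (heq_of_eq ?_) (heq_of_eq ?_)⟩
  · refine (X.map_comp _ _ _).symm.trans (Eq.trans ?_ (X.map_id σ))
    congr 1
    exact CubeMap.ext (Function.Embedding.ext fun i => (isEmpty_compl_empty_compl.false i).elim)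
      (funext fun i => (isEmpty_compl_empty_compl.false i).elim)
  · refine (Y.map_comp _ _ _).symm.trans (Eq.trans ?_ (Y.map_id τ))
    congr 1
    exact CubeMap.ext rfl (CubeMap.comp_off_of_false _ _ fun _ => rfl)

theorem exists_eq_slice_of_edge (e : (X.prod Y).Edge) :
    (∃ (a : X.Edge) (y : Y.Vertex), (sliceLeft X y).app a = e) ∨
      ∃ (x : X.Vertex) (b : Y.Edge), (sliceRight Y x).app b = e := by
  by_cases h : (0 : Fin 1) ∈ e.S
  · refine Or.inl (exists_eq_sliceLeft e (Set.eq_univ_of_forall fun i => ?_))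
    rwa [Subsingleton.elim i 0]
  · refine Or.inr (exists_eq_sliceRight e (Set.eq_empty_of_forall_notMem fun i => ?_))
    rwa [Subsingleton.elim i 0]

theorem sliceLeft_vertex (x : X.Vertex) (y : Y.Vertex) :
    (sliceLeft X y).app x = (sliceRight Y x).app y := by
  refine ProdCube.ext_of_map (Set.ext fun i => i.elim0) ?_ ?_
  · refine (X.map_comp _ _ _).symm.trans ?_
    change _ = X.map _ x
    congr 1
    exact CubeMap.ext (Function.Embedding.ext fun i => (isEmpty_compl_empty_compl.false i).elim)
      (funext fun k => k.elim0)
  · refine (Y.map_comp _ _ _).symm.trans ?_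
    change _ = Y.map _ y
    congr 1
    exact CubeMap.ext (Function.Embedding.ext fun i => i.1.elim0) (funext fun k => k.elim0)

theorem exists_eq_vertex (c : (X.prod Y).Vertex) :
    ∃ (x : X.Vertex) (y : Y.Vertex), (sliceLeft X y).app x = c :=
  exists_eq_sliceLeft c (Set.ext fun i => i.elim0)

theorem map_injective_of_isEmpty {ι : Type} [IsEmpty ι] (f : CubeMap ι (Fin 0)) :
    Function.Injective (X.map f) := by
  intro x y h
  have key : ∀ t : X.Vertex, X.map (⟨⟨fun i => i.elim0, fun i => i.elim0⟩, fun _ => false⟩ :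
      CubeMap (Fin 0) ι) (X.map f t) = t := by
    intro t
    rw [← X.map_comp]
    refine Eq.trans ?_ (X.map_id t)
    congr 1
    exact CubeMap.ext (Function.Embedding.ext fun i => i.elim0) (funext fun k => k.elim0)
  rw [← key x, h, key]

theorem sliceLeft_vertex_injective {x x' : X.Vertex} {y y' : Y.Vertex}
    (h : (sliceLeft X y).app x = (sliceLeft X y').app x') : x = x' ∧ y = y' := by
  constructor
  · rw [sliceLeft_vertex, sliceLeft_vertex] at h
    exact map_injective_of_isEmpty _ (eq_of_heq ((ProdCube.mk.injEq ..).mp h).2.1)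
  · exact map_injective_of_isEmpty _ (eq_of_heq ((ProdCube.mk.injEq ..).mp h).2.2)

theorem sliceLeft_ne_sliceRight (a : X.Edge) (y : Y.Vertex) (x : X.Vertex) (b : Y.Edge) :
    (sliceLeft X y).app a ≠ (sliceRight Y x).app b := by
  intro h
  have h1 : (Set.univ : Set (Fin 1)) = ∅ := congrArg ProdCube.S h
  exact (h1 ▸ Set.mem_univ (0 : Fin 1) : (0 : Fin 1) ∈ (∅ : Set (Fin 1)))

theorem prodMap_sliceLeft (f : Hom X X') (g : Hom Y Y') (y : Y.Vertex) {ι : Type}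
    (σ : X.cubes ι) :
    (f.prodMap g).app ((sliceLeft X y).app σ) = (sliceLeft X' (g.app y)).app (f.app σ) :=
  ProdCube.ext rfl (heq_of_eq (f.app_map _ _)) (heq_of_eq (g.app_map _ _))

theorem prodMap_sliceRight (f : Hom X X') (g : Hom Y Y') (x : X.Vertex) {ι : Type}
    (τ : Y.cubes ι) :
    (f.prodMap g).app ((sliceRight Y x).app τ) = (sliceRight Y' (f.app x)).app (g.app τ) :=
  ProdCube.ext rfl (heq_of_eq (f.app_map _ _)) (heq_of_eq (g.app_map _ _))

theorem prod_isConnected (hX : X.IsConnected) (hY : Y.IsConnected) : (X.prod Y).IsConnected := by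
  obtain ⟨⟨x⟩, hX⟩ := hX
  obtain ⟨⟨y⟩, hY⟩ := hY
  refine ⟨⟨(sliceLeft X y).app x⟩, fun c d => ?_⟩
  obtain ⟨x, y, rfl⟩ := exists_eq_vertex c
  obtain ⟨x', y', rfl⟩ := exists_eq_vertex d
  obtain ⟨l, hl⟩ := hX x x'
  obtain ⟨m, hm⟩ := hY y y'
  refine ⟨l.map (sliceLeft X y).app ++ m.map (sliceRight Y x').app,
    isEdgePath_append.mpr ⟨_, hl.map (sliceLeft X y), ?_⟩⟩
  rw [sliceLeft_vertex, sliceLeft_vertex]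
  exact hm.map (sliceRight Y x')

/-- The map from a cube with one direction, indexed by a subset of `Fin 2`, to the standard
edge. -/
def _root_.CubeMap.toEdge (S : Set (Fin 2)) (hS : S.Subsingleton) : CubeMap S (Fin 1) where
  dir := ⟨fun _ => 0, fun i j _ => Subtype.ext (hS i.2 j.2)⟩
  off := fun _ => false

theorem subsingleton_compl_singleton (i : Fin 2) : ({i}ᶜ : Set (Fin 2)).Subsingleton := by
  intro j hj k hk
  simp only [Set.mem_compl_iff, Set.mem_singleton_iff] at hj hk
  omega

/-- The square spanned by an edge of each factor; the edge of `X` gives the direction `i`. -/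
def prodSquare (i : Fin 2) (a : X.Edge) (b : Y.Edge) : (X.prod Y).Square :=
  ⟨{i}, X.map (CubeMap.toEdge _ Set.subsingleton_singleton) a,
    Y.map (CubeMap.toEdge _ (subsingleton_compl_singleton i)) b⟩

theorem _root_.CubeMap.toEdge_comp_off {ι : Type} (S : Set (Fin 2)) (hS : S.Subsingleton)
    (f : CubeMap ι S) (k : S) : ((CubeMap.toEdge S hS).comp f).off = fun _ => f.off k := by
  funext j
  obtain rfl : j = (CubeMap.toEdge S hS).dir k := Subsingleton.elim _ _
  exact ((CubeMap.toEdge S hS).apply_dir f.off k).trans (Bool.false_xor _)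

theorem map_map_map {ι κ μ ν : Type} (f : CubeMap ι κ) (g : CubeMap κ μ) (h : CubeMap μ ν)
    (σ : X.cubes ν) : X.map f (X.map g (X.map h σ)) = X.map ((h.comp g).comp f) σ := by
  rw [X.map_comp, X.map_comp]

theorem side_prodSquare_zero (a : X.Edge) (b : Y.Edge) (c : Bool) :
    (X.prod Y).side (prodSquare 0 a b) ![false, c] 0 =
      (sliceLeft X (Y.corner b fun _ => c)).app a := by
  have hS : (CubeMap.edge ![false, c] (0 : Fin 2)).dir ⁻¹' {0} = Set.univ :=
    Set.eq_univ_of_forall fun _ => rfl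
  refine ProdCube.ext_of_map hS ?_ ?_
  · refine (map_map_map _ _ _ a).trans (congrArg (X.map · a) ?_)
    refine CubeMap.ext (Function.Embedding.ext fun i => Subsingleton.elim _ _) ?_
    refine (CubeMap.comp_off_of_false _ _ fun _ => rfl).trans ?_
    exact CubeMap.toEdge_comp_off _ _ _ ⟨0, Set.mem_singleton 0⟩
  · refine (map_map_map _ _ _ b).trans (Eq.trans (congrArg (Y.map · b) ?_)
      (Y.map_comp _ _ _))
    refine CubeMap.ext (Function.Embedding.ext fun i => (isEmpty_compl_univ.false i).elim) ?_
    refine (CubeMap.comp_off_of_false _ _ fun _ => rfl).trans ?_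
    refine (CubeMap.toEdge_comp_off _ _ _ ⟨1, by simp⟩).trans ?_
    exact (CubeMap.comp_off_of_false (CubeMap.corner _)
      (CubeMap.ofIsEmpty ((Set.univ : Set (Fin 1))ᶜ : Set (Fin 1))) fun _ => rfl).symm

theorem side_prodSquare_one (a : X.Edge) (b : Y.Edge) (c : Bool) :
    (X.prod Y).side (prodSquare 1 a b) ![false, c] 0 =
      (sliceRight Y (X.corner a fun _ => c)).app b := by
  have hS : (CubeMap.edge ![false, c] (0 : Fin 2)).dir ⁻¹' {1} = ∅ :=
    Set.eq_empty_of_forall_notMem fun _ h => zero_ne_one (α := Fin 2) h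
  refine ProdCube.ext_of_map hS ?_ ?_
  · refine (map_map_map _ _ _ a).trans (Eq.trans (congrArg (X.map · a) ?_)
      (X.map_comp _ _ _))
    refine CubeMap.ext
      (Function.Embedding.ext fun i => (isEmpty_compl_empty_compl.false i).elim) ?_
    refine (CubeMap.comp_off_of_false _ _ fun _ => rfl).trans ?_
    refine (CubeMap.toEdge_comp_off _ _ _ ⟨1, Set.mem_singleton 1⟩).trans ?_
    exact (CubeMap.comp_off_of_false (CubeMap.corner _)
      (CubeMap.ofIsEmpty (∅ : Set (Fin 1))) fun _ => rfl).symm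
  · refine (map_map_map _ _ _ b).trans (congrArg (Y.map · b) ?_)
    refine CubeMap.ext (Function.Embedding.ext fun i => Subsingleton.elim _ _) ?_
    refine (CubeMap.comp_off_of_false _ _ fun _ => rfl).trans ?_
    exact CubeMap.toEdge_comp_off _ _ _ ⟨0, by simp⟩

theorem hyp_sliceLeft (hY : Y.IsConnected) (a : X.Edge) (y y' : Y.Vertex) :
    (X.prod Y).hyp ((sliceLeft X y).app a) = (X.prod Y).hyp ((sliceLeft X y').app a) := by
  refine hY.rec_vertex (P := fun t => (X.prod Y).hyp ((sliceLeft X y).app a) =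
    (X.prod Y).hyp ((sliceLeft X t).app a)) rfl (fun b hb => hb.trans ?_) y'
  have h := hyp_side_zero (prodSquare 0 a b)
  rwa [side_prodSquare_zero, side_prodSquare_zero] at h

theorem hyp_sliceRight (hX : X.IsConnected) (b : Y.Edge) (x x' : X.Vertex) :
    (X.prod Y).hyp ((sliceRight Y x).app b) = (X.prod Y).hyp ((sliceRight Y x').app b) := by
  refine hX.rec_vertex (P := fun t => (X.prod Y).hyp ((sliceRight Y x).app b) =
    (X.prod Y).hyp ((sliceRight Y t).app b)) rfl (fun a ha => ha.trans ?_) x'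
  have h := hyp_side_zero (prodSquare 1 a b)
  rwa [side_prodSquare_one, side_prodSquare_one] at h

end Products

end CubeComplex

/-! ### Deck transformations and convex subcomplexes -/

namespace CubeComplex

section Deck

variable {X : CubeComplex.{u}} {Y : CubeComplex.{v}} {p : Hom Y X}

theorem app_deckHom (g : deckGroup p) {ι : Type} (σ : Y.cubes ι) :
    p.app ((deckHom g).app σ) = p.app σ :=
  g.2.2 σ

theorem deckHom_inv_app (g : deckGroup p) {ι : Type} (σ : Y.cubes ι) :
    (deckHom g⁻¹).app ((deckHom g).app σ) = σ :=
  (g.1 ι).symm_apply_apply σ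

theorem deckHom_app_inv (g : deckGroup p) {ι : Type} (σ : Y.cubes ι) :
    (deckHom g).app ((deckHom g⁻¹).app σ) = σ :=
  (g.1 ι).apply_symm_apply σ

theorem deckHom_mul (g h : deckGroup p) {ι : Type} (σ : Y.cubes ι) :
    (deckHom (g * h)).app σ = (deckHom g).app ((deckHom h).app σ) := rfl

/-- Deck transformations that agree at a vertex are equal. -/
theorem deck_ext (hX : X.IsWeaklySpecial) (hp : p.IsUniversalCover) {g h : deckGroup p}
    {x : Y.Vertex} (hx : (deckHom g).app x = (deckHom h).app x) : g = h := by
  refine Subtype.ext (funext fun ι => Equiv.ext fun σ => ?_)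
  exact Hom.app_eq_of_hyp_eq hX hp.isCovering hp.isSimplyConnected.1 (deckHom g) (deckHom h) hx
    (fun e => congrArg X.hyp ((app_deckHom g e).trans (app_deckHom h e).symm)) σ

theorem IsGeodesic.deckHom (g : deckGroup p) {x y : Y.Vertex} {l : List Y.Edge}
    (h : Y.IsGeodesic x l y) :
    Y.IsGeodesic ((deckHom g).app x) (l.map (deckHom g).app) ((deckHom g).app y) := by
  refine ⟨h.1.map _, fun m hm => ?_⟩
  have hm' := hm.map (CubeComplex.deckHom g⁻¹)
  rw [deckHom_inv_app, deckHom_inv_app] at hm'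
  simpa using h.2 _ hm'

namespace Subcomplex

/-- The translate `g A` of a subcomplex by a deck transformation. -/
def translate (g : deckGroup p) (A : Subcomplex Y) : Subcomplex Y where
  carrier := fun ι => {σ | (deckHom g⁻¹).app σ ∈ A.carrier ι}
  map_mem := by
    intro ι κ f σ hσ
    change (deckHom g⁻¹).app (Y.map f σ) ∈ A.carrier ι
    rw [(deckHom g⁻¹).app_map]
    exact A.map_mem f hσ

theorem deckHom_mem_translate (g : deckGroup p) (A : Subcomplex Y) {ι : Type} {σ : Y.cubes ι} :
    (deckHom g).app σ ∈ (A.translate g).carrier ι ↔ σ ∈ A.carrier ι := by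
  change (deckHom g⁻¹).app ((deckHom g).app σ) ∈ A.carrier ι ↔ _
  rw [deckHom_inv_app]

theorem IsConvex.translate {A : Subcomplex Y} (hA : A.IsConvex) (g : deckGroup p) :
    (A.translate g).IsConvex := by
  refine ⟨?_, fun {ι} σ hb he => ?_, fun x hx y hy l hl e he => ?_⟩
  · obtain ⟨x, hx⟩ := hA.nonempty
    exact ⟨_, (deckHom_mem_translate g A).mpr hx⟩
  · refine hA.isLocallyConvex ((deckHom g⁻¹).app σ) ?_ fun i => ?_
    · rw [← (deckHom g⁻¹).app_base]; exact hb
    · have : (deckHom g⁻¹).app (Y.baseEdge σ i) = Y.baseEdge ((deckHom g⁻¹).app σ) i :=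
        (deckHom g⁻¹).app_map _ _
      rw [← this]; exact he i
  · exact hA.geodesic_mem _ hx _ hy _ (hl.deckHom g⁻¹) _ (List.mem_map_of_mem he)

theorem hyperplanes_translate (g : deckGroup p) (A : Subcomplex Y) :
    (A.translate g).hyperplanes = (deckHom g).hypMap '' A.hyperplanes := by
  ext H
  constructor
  · rintro ⟨e, he, rfl⟩
    refine ⟨_, ⟨_, he, rfl⟩, ?_⟩
    rw [← Hom.hyp_app, deckHom_app_inv]
  · rintro ⟨_, ⟨e, he, rfl⟩, rfl⟩
    exact ⟨_, (deckHom_mem_translate g A).mpr he, rfl⟩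

/-- A subcomplex that `g` and its inverse map into itself is stabilised by `g`. -/
theorem mem_stab_of_forall {A : Subcomplex Y} {g : deckGroup p}
    (h : ∀ {ι : Type}, ∀ σ ∈ A.carrier ι, (deckHom g).app σ ∈ A.carrier ι)
    (h' : ∀ {ι : Type}, ∀ σ ∈ A.carrier ι, (deckHom g⁻¹).app σ ∈ A.carrier ι) :
    g ∈ A.stab p := by
  intro ι σ
  refine ⟨fun hσ => ?_, h σ⟩
  have := h' _ hσ
  rwa [show g.1 ι σ = (deckHom g).app σ from rfl, deckHom_inv_app] at this

theorem exists_edgePath_toComplex {A : Subcomplex Y} {l : List Y.Edge} {x y : A.toComplex.Vertex}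
    (h : Y.IsEdgePath x.1 l y.1) (hl : ∀ e ∈ l, e ∈ A.carrier (Fin 1)) :
    ∃ m, A.toComplex.IsEdgePath x m y := by
  induction l generalizing x with
  | nil => exact ⟨[], Subtype.ext h⟩
  | cons e l ih =>
    have he := hl e (by simp)
    obtain ⟨m, hm⟩ := ih (x := A.toComplex.tgt ⟨e, he⟩) h.2
      fun f hf => hl f (List.mem_cons_of_mem _ hf)
    exact ⟨⟨e, he⟩ :: m, Subtype.ext h.1, hm⟩

theorem IsConvex.isConnected_toComplex {A : Subcomplex Y} (hA : A.IsConvex)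
    (hY : Y.IsConnected) : A.toComplex.IsConnected := by
  obtain ⟨x, hx⟩ := hA.nonempty
  refine ⟨⟨⟨x, hx⟩⟩, fun y z => ?_⟩
  obtain ⟨l, hl⟩ := exists_isGeodesic hY y.1 z.1
  exact exists_edgePath_toComplex hl.1 (hA.geodesic_mem _ y.2 _ z.2 l hl)

theorem IsConvex.edge_mem {A : Subcomplex Y} (hA : A.IsConvex) {e : Y.Edge}
    (hne : Y.src e ≠ Y.tgt e) (hs : Y.src e ∈ A.carrier (Fin 0))
    (ht : Y.tgt e ∈ A.carrier (Fin 0)) : e ∈ A.carrier (Fin 1) := by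
  refine hA.geodesic_mem _ hs _ ht [e] ⟨⟨rfl, rfl⟩, fun m hm => ?_⟩ e (by simp)
  cases m with
  | nil => exact absurd hm hne
  | cons f m => simp

theorem edge_mem_hull {S : Subcomplex Y} {e : Y.Edge} (hne : Y.src e ≠ Y.tgt e)
    (hs : Y.src e ∈ S.hull.carrier (Fin 0)) (ht : Y.tgt e ∈ S.hull.carrier (Fin 0)) :
    e ∈ S.hull.carrier (Fin 1) :=
  fun C hC hS => hC.edge_mem hne (hs C hC hS) (ht C hC hS)

/-! ### The product subcomplex -/

section ProductIso

variable {A B : Subcomplex Y} {x : Y.Vertex} {hxA : x ∈ A.carrier (Fin 0)}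
  {hxB : x ∈ B.carrier (Fin 0)} {φ : Hom (A.toComplex.prod B.toComplex) Y}

theorem IsProductIso.hyp_left (hφ : A.IsProductIso B hxA hxB φ) (hB : B.toComplex.IsConnected)
    (e : A.toComplex.Edge) (b : B.toComplex.Vertex) :
    Y.hyp (φ.app ((sliceLeft A.toComplex b).app e)) = Y.hyp e.1 := by
  rw [← hφ.left e]
  exact φ.hyp_congr (hyp_sliceLeft hB e b _)

theorem IsProductIso.hyp_right (hφ : A.IsProductIso B hxA hxB φ) (hA : A.toComplex.IsConnected)
    (f : B.toComplex.Edge) (a : A.toComplex.Vertex) :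
    Y.hyp (φ.app ((sliceRight B.toComplex a).app f)) = Y.hyp f.1 := by
  rw [← hφ.right f]
  exact φ.hyp_congr (hyp_sliceRight hA f a _)

theorem IsProductIso.vertex_right (hφ : A.IsProductIso B hxA hxB φ) (b : B.toComplex.Vertex) :
    φ.app ((sliceLeft A.toComplex b).app ⟨x, hxA⟩) = b.1 :=
  (congrArg φ.app (sliceLeft_vertex _ _)).trans (hφ.right b)

/-- If the maps `f` of `A` and `f'` of `B` preserve the projections of edges to `X`, and the deck
transformation `g` agrees with `f × f'` at the base vertex, then `g` acts on the product
subcomplex as `f × f'`. -/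
theorem IsProductIso.deckHom_app (hX : X.IsWeaklySpecial) (hp : p.IsCovering)
    (hφ : A.IsProductIso B hxA hxB φ) (hA : A.toComplex.IsConnected)
    (hB : B.toComplex.IsConnected) (g : deckGroup p) (f : Hom A.toComplex A.toComplex)
    (f' : Hom B.toComplex B.toComplex)
    (hf : ∀ e : A.toComplex.Edge, p.app (f.app e).1 = p.app e.1)
    (hf' : ∀ e : B.toComplex.Edge, p.app (f'.app e).1 = p.app e.1)
    (hx : (deckHom g).app x =
      φ.app ((sliceLeft A.toComplex (f'.app ⟨x, hxB⟩)).app (f.app ⟨x, hxA⟩)))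
    {ι : Type} (c : (A.toComplex.prod B.toComplex).cubes ι) :
    (deckHom g).app (φ.app c) = φ.app ((f.prodMap f').app c) := by
  refine Hom.app_eq_of_hyp_eq hX hp (prod_isConnected hA hB) ((deckHom g).comp φ)
    (φ.comp (f.prodMap f')) 
    (z := (sliceLeft A.toComplex (Y := B.toComplex) ⟨x, hxB⟩).app ⟨x, hxA⟩) ?_ ?_ c
  · change (deckHom g).app (φ.app _) = φ.app ((f.prodMap f').app _)
    exact (congrArg (deckHom g).app (hφ.vertex_right ⟨x, hxB⟩)).trans
      (hx.trans (congrArg φ.app (prodMap_sliceLeft f f' _ _).symm))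
  · intro e
    change X.hyp (p.app ((deckHom g).app (φ.app e))) = X.hyp (p.app (φ.app ((f.prodMap f').app e)))
    rw [app_deckHom]
    obtain ⟨a, b, rfl⟩ | ⟨a, b, rfl⟩ := exists_eq_slice_of_edge e
    · rw [prodMap_sliceLeft, p.hyp_congr (hφ.hyp_left hB a b), p.hyp_congr (hφ.hyp_left hB _ _), hf]
    · rw [prodMap_sliceRight, p.hyp_congr (hφ.hyp_right hA b a),
        p.hyp_congr (hφ.hyp_right hA _ _), hf']

/-- A deck transformation that maps the vertex `b` of `B` to the vertex `b'` of `B` maps the slice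
of `A` at `b` identically to the slice at `b'`. -/
theorem IsProductIso.deckHom_app_sliceLeft (hX : X.IsWeaklySpecial) (hp : p.IsCovering)
    (hφ : A.IsProductIso B hxA hxB φ) (hA : A.toComplex.IsConnected)
    (hB : B.toComplex.IsConnected) {g : deckGroup p} {b b' : B.toComplex.Vertex}
    (hb : (deckHom g).app b.1 = b'.1) {ι : Type} (σ : A.toComplex.cubes ι) :
    (deckHom g).app (φ.app ((sliceLeft A.toComplex b).app σ)) =
      φ.app ((sliceLeft A.toComplex b').app σ) := by
  refine Hom.app_eq_of_hyp_eq hX hp hA ((deckHom g).comp (φ.comp (sliceLeft A.toComplex b)))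
    (φ.comp (sliceLeft A.toComplex b')) (z := ⟨x, hxA⟩) ?_ ?_ σ
  · change (deckHom g).app (φ.app _) = φ.app _
    rw [hφ.vertex_right, hφ.vertex_right, hb]
  · intro e
    change X.hyp (p.app ((deckHom g).app (φ.app _))) = X.hyp (p.app (φ.app _))
    rw [app_deckHom, p.hyp_congr (hφ.hyp_left hB e b), p.hyp_congr (hφ.hyp_left hB e b')]

theorem translate_slice (hX : X.IsWeaklySpecial) (hp : p.IsCovering)
    (hφ : A.IsProductIso B hxA hxB φ) (hA : A.toComplex.IsConnected)
    (hB : B.toComplex.IsConnected) {g : deckGroup p} {b b' : B.toComplex.Vertex}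
    (hb : (deckHom g).app b.1 = b'.1) : (slice φ b).translate g = slice φ b' := by
  have key : ∀ (ι : Type) (τ : Y.cubes ι),
      τ ∈ ((slice φ b).translate g).carrier ι ↔ τ ∈ (slice φ b').carrier ι := by
    intro ι τ
    have hτ := deckHom_app_inv g τ
    constructor
    · rintro ⟨σ, hσ⟩
      refine ⟨σ, ?_⟩
      change φ.app _ = _
      rw [← hφ.deckHom_app_sliceLeft hX hp hA hB hb, ← hτ, ← hσ]
      rfl
    · rintro ⟨σ, rfl⟩
      refine ⟨σ, ?_⟩
      change φ.app _ = (deckHom g⁻¹).app (φ.app _)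
      rw [← hφ.deckHom_app_sliceLeft hX hp hA hB hb, deckHom_inv_app]
  have hc : ((slice φ b).translate g).carrier = (slice φ b').carrier :=
    funext fun ι => Set.ext (key ι)
  generalize (slice φ b).translate g = C at hc
  generalize slice φ b' = D at hc
  cases C; cases D
  cases hc
  rfl

/-- A deck transformation that maps some vertex of `B` into `B` permutes the slices of `A`,
since these are all the convex subcomplexes parallel to `A`. Thus it maps `B` into the product
subcomplex. -/
theorem deckHom_vertex_mem_range (hX : X.IsWeaklySpecial) (hp : p.IsCovering)
    (hφ : A.IsProductIso B hxA hxB φ)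
    (hpar : ∀ A' : Subcomplex Y, (A'.IsConvex ∧ A'.Parallel A) ↔
      ∃ b : B.toComplex.Vertex, A' = slice φ b) (hA : A.toComplex.IsConnected)
    (hB : B.toComplex.IsConnected) {g : deckGroup p} {b b' : B.toComplex.Vertex}
    (hb : (deckHom g).app b.1 = b'.1) (t : B.toComplex.Vertex) :
    (deckHom g).app t.1 ∈ φ.range.carrier (Fin 0) := by
  have hslice : ∀ t, (slice φ t).IsConvex ∧ (slice φ t).hyperplanes = A.hyperplanes :=
    fun t => (hpar _).mpr ⟨t, rfl⟩
  have hg : (deckHom g).hypMap '' A.hyperplanes = A.hyperplanes := by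
    rw [← (hslice b).2, ← hyperplanes_translate, translate_slice hX hp hφ hA hB hb, (hslice b).2,
      (hslice b').2]
  obtain ⟨t', ht'⟩ := (hpar ((slice φ t).translate g)).mp ⟨(hslice t).1.translate g, by
    unfold Parallel
    rw [hyperplanes_translate, (hslice t).2, hg]⟩
  have hmem : (deckHom g).app t.1 ∈ ((slice φ t).translate g).carrier (Fin 0) :=
    (deckHom_mem_translate g _).mpr ⟨_, hφ.vertex_right t⟩
  rw [ht'] at hmem
  obtain ⟨a, ha⟩ := hmem
  exact ⟨_, ha⟩

/-- If `g` maps the origin of an edge `f` of `B` into `B`, then `g f` lies in the product subcomplex.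
It is an edge of `B`, because the edges of the slice of `A` at its origin are images of edges of a
slice of `A`. -/
theorem deckHom_edge_mem (hX : X.IsWeaklySpecial) (hp : p.IsCovering)
    (hφ : A.IsProductIso B hxA hxB φ)
    (hpar : ∀ A' : Subcomplex Y, (A'.IsConvex ∧ A'.Parallel A) ↔
      ∃ b : B.toComplex.Vertex, A' = slice φ b) (hA : A.toComplex.IsConnected)
    (hB : B.toComplex.IsConnected) {g : deckGroup p} (f : B.toComplex.Edge)
    (hf : (deckHom g).app (B.toComplex.src f).1 ∈ B.carrier (Fin 0)) :
    (deckHom g).app f.1 ∈ B.carrier (Fin 1) := by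
  have hb : (deckHom g).app (B.toComplex.src f).1 =
      (⟨_, hf⟩ : B.toComplex.Vertex).1 := rfl
  have hvert := deckHom_vertex_mem_range hX hp hφ hpar hA hB hb
  have hsrc : (deckHom g).app (B.toComplex.src f).1 = Y.src ((deckHom g).app f.1) :=
    (deckHom g).app_src f.1
  have htgt : (deckHom g).app (B.toComplex.tgt f).1 = Y.tgt ((deckHom g).app f.1) :=
    (deckHom g).app_tgt f.1
  have hmem : (deckHom g).app f.1 ∈ φ.range.carrier (Fin 1) := by
    rw [hφ.range_eq] at hvert ⊢
    -- The hull contains any edge that joins two of its vertices: it is a geodesic, as `X` and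
    -- hence `Y` has no loops.
    refine edge_mem_hull ?_ (hsrc ▸ hvert _) (htgt ▸ hvert _)
    intro h
    refine hX.src_ne_tgt (p.app ((deckHom g).app f.1)) ?_
    rw [← p.app_src, ← p.app_tgt, h]
  obtain ⟨c, hc⟩ := hmem
  rw [← hc, ← φ.app_src] at hsrc
  have hsrc' := hφ.isEmbedding _ ((hφ.vertex_right ⟨_, hf⟩).trans hsrc)
  obtain ⟨a, b, rfl⟩ | ⟨a, b, rfl⟩ := exists_eq_slice_of_edge c
  · -- Here `g f` would be an edge of the slice of `A` at the image of the origin of `f`, hence the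
    -- image of an edge of the slice at the origin of `f`; but `f` is not an edge of that slice.
    exfalso
    rw [← Hom.app_src] at hsrc'
    obtain ⟨-, hb'⟩ := sliceLeft_vertex_injective hsrc'
    subst hb'
    rw [← hφ.deckHom_app_sliceLeft hX hp hA hB hb] at hc
    have h := congrArg (deckHom g⁻¹).app hc
    rw [deckHom_inv_app, deckHom_inv_app, ← hφ.right f] at h
    exact sliceLeft_ne_sliceRight _ _ _ _ (hφ.isEmbedding _ h)
  · rw [← Hom.app_src, ← sliceLeft_vertex] at hsrc'
    obtain ⟨ha, -⟩ := sliceLeft_vertex_injective hsrc'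
    rw [← hc, ← ha, hφ.right b]
    exact b.2

theorem deckHom_mem (hX : X.IsWeaklySpecial) (hp : p.IsCovering)
    (hφ : A.IsProductIso B hxA hxB φ)
    (hpar : ∀ A' : Subcomplex Y, (A'.IsConvex ∧ A'.Parallel A) ↔
      ∃ b : B.toComplex.Vertex, A' = slice φ b) (hA : A.toComplex.IsConnected)
    (hB : B.toComplex.IsConnected) (hBc : B.IsConvex) {g : deckGroup p} (b : B.toComplex.Vertex)
    (hb : (deckHom g).app b.1 ∈ B.carrier (Fin 0)) {ι : Type} (σ : Y.cubes ι)
    (hσ : σ ∈ B.carrier ι) : (deckHom g).app σ ∈ B.carrier ι := by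
  have hedge := deckHom_edge_mem hX hp hφ hpar hA hB (g := g)
  have hvert : ∀ t : B.toComplex.Vertex, (deckHom g).app t.1 ∈ B.carrier (Fin 0) := by
    refine hB.rec_vertex hb fun f hf => ?_
    have h := B.map_mem (CubeMap.corner fun _ => true) (hedge f hf)
    rwa [← (deckHom g).app_map] at h
  refine hBc.isLocallyConvex _ ?_ fun i => ?_
  · rw [← (deckHom g).app_base]
    exact hvert ⟨_, B.map_mem _ hσ⟩
  · have h := hedge ⟨Y.baseEdge σ i, B.map_mem _ hσ⟩ (hvert _)
    rwa [show (deckHom g).app (Y.baseEdge σ i) = Y.baseEdge ((deckHom g).app σ) i from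
      (deckHom g).app_map _ _] at h

/-- The stabiliser of `B` contains each deck transformation that maps some vertex of `B` into `B`.
This is what makes the quotient of `B` embed in `X`. -/
theorem mem_stab_of_vertex (hX : X.IsWeaklySpecial) (hp : p.IsCovering)
    (hφ : A.IsProductIso B hxA hxB φ)
    (hpar : ∀ A' : Subcomplex Y, (A'.IsConvex ∧ A'.Parallel A) ↔
      ∃ b : B.toComplex.Vertex, A' = slice φ b) (hA : A.toComplex.IsConnected)
    (hB : B.toComplex.IsConnected) (hBc : B.IsConvex) {g : deckGroup p} (b : B.toComplex.Vertex)
    (hb : (deckHom g).app b.1 ∈ B.carrier (Fin 0)) : g ∈ B.stab p := by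
  refine mem_stab_of_forall (deckHom_mem hX hp hφ hpar hA hB hBc b hb)
    (deckHom_mem hX hp hφ hpar hA hB hBc ⟨_, hb⟩ ?_)
  rw [deckHom_inv_app]
  exact b.2

end ProductIso

end Subcomplex

end Deck

end CubeComplex

theorem proposition3p8
    (X : CubeComplex.{u}) (hXconn : X.IsConnected) (hX : X.IsWeaklySpecial)
    (Y : CubeComplex.{v}) (p : CubeComplex.Hom Y X) (hp : p.IsUniversalCover)
    (A : CubeComplex.Subcomplex Y) (hA : A.IsConvex)
    (x : Y.Vertex) (hxA : x ∈ A.carrier (Fin 0))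
    (B : CubeComplex.Subcomplex Y) (hB : A.IsOrthogonalComplement hxA B) :
    (B.quotientHom p).IsEmbedding ∧
    (∀ g ∈ A.stab p, ∀ h ∈ B.stab p, g * h = h * g) ∧
    (∃ φ : CubeComplex.Hom (A.toComplex.prod B.toComplex) Y, A.IsProductIso B hxA hB.mem φ) ∧
    ∀ φ : CubeComplex.Hom (A.toComplex.prod B.toComplex) Y, A.IsProductIso B hxA hB.mem φ →
      A.stab p ≤ φ.range.stab p ∧
      B.stab p ≤ φ.range.stab p ∧
      (∀ (g : A.stab p) (ι : Type) (c : (A.toComplex.prod B.toComplex).cubes ι),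
        (CubeComplex.deckHom g.1).app (φ.app c) =
          φ.app (((A.stabHom g).prodMap (CubeComplex.Hom.id B.toComplex)).app c)) ∧
      (∀ (g : B.stab p) (ι : Type) (c : (A.toComplex.prod B.toComplex).cubes ι),
        (CubeComplex.deckHom g.1).app (φ.app c) =
          φ.app (((CubeComplex.Hom.id A.toComplex).prodMap (B.stabHom g)).app c)) := by
  have hAc := hA.isConnected_toComplex hp.isSimplyConnected.1
  have hBc := hB.isConvex.isConnected_toComplex hp.isSimplyConnected.1
  have hcov : p.IsCovering := hp.isCovering
  obtain ⟨φ₀, hφ₀, hpar⟩ := hB.parallel_iff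
  have actA : ∀ φ : CubeComplex.Hom (A.toComplex.prod B.toComplex) Y,
      A.IsProductIso B hxA hB.mem φ → ∀ (g : A.stab p) (ι : Type)
      (c : (A.toComplex.prod B.toComplex).cubes ι), (CubeComplex.deckHom g.1).app (φ.app c) =
        φ.app (((A.stabHom g).prodMap (CubeComplex.Hom.id B.toComplex)).app c) := by
    intro φ hφ g ι c
    exact hφ.deckHom_app hX hcov hAc hBc g.1 (A.stabHom g) (CubeComplex.Hom.id B.toComplex)
      (fun e => g.1.2.2 e.1) (fun _ => rfl)
      (hφ.left ((A.stabHom g).app ⟨x, hxA⟩)).symm c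
  have actB : ∀ φ : CubeComplex.Hom (A.toComplex.prod B.toComplex) Y,
      A.IsProductIso B hxA hB.mem φ → ∀ (g : B.stab p) (ι : Type)
      (c : (A.toComplex.prod B.toComplex).cubes ι), (CubeComplex.deckHom g.1).app (φ.app c) =
        φ.app (((CubeComplex.Hom.id A.toComplex).prodMap (B.stabHom g)).app c) := by
    intro φ hφ g ι c
    exact hφ.deckHom_app hX hcov hAc hBc g.1 (CubeComplex.Hom.id A.toComplex) (B.stabHom g)
      (fun _ => rfl) (fun e => g.1.2.2 e.1)
      (hφ.vertex_right ((B.stabHom g).app ⟨x, hB.mem⟩)).symm c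
  refine ⟨?_, ?_, ⟨φ₀, hφ₀⟩, fun φ hφ => ⟨?_, ?_, actA φ hφ, actB φ hφ⟩⟩
  · rintro ι ⟨σ⟩ ⟨τ⟩ h
    replace h : p.app σ.1 = p.app τ.1 := h
    obtain ⟨g, hg⟩ := hp.exists_deck hX (x := Y.base σ.1) (z := Y.base τ.1)
      (by rw [p.app_base, p.app_base, h])
    have hστ : (CubeComplex.deckHom g).app σ.1 = τ.1 := by
      refine hcov.eq_of_base_eq ?_ ?_
      · rw [CubeComplex.app_deckHom, h]
      · rw [← CubeComplex.Hom.app_base, hg]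
    refine Quot.sound ⟨⟨g, ?_⟩, Subtype.ext hστ⟩
    refine CubeComplex.Subcomplex.mem_stab_of_vertex hX hcov hφ₀ hpar hAc hBc hB.isConvex
      (B.toComplex.base σ) ?_
    exact hg.symm ▸ B.map_mem _ τ.2
  · intro g hg h hh
    refine CubeComplex.deck_ext hX hp (x := x) ?_
    have h1 : _ = x := hφ₀.vertex_right ⟨x, hB.mem⟩
    rw [CubeComplex.deckHom_mul, CubeComplex.deckHom_mul, ← h1, actA φ₀ hφ₀ ⟨g, hg⟩,
      actB φ₀ hφ₀ ⟨h, hh⟩, actA φ₀ hφ₀ ⟨g, hg⟩, actB φ₀ hφ₀ ⟨h, hh⟩]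
    rfl
  · intro g hg
    refine CubeComplex.Subcomplex.mem_stab_of_forall ?_ ?_
    · rintro ι _ ⟨c, rfl⟩
      exact ⟨_, (actA φ hφ ⟨g, hg⟩ ι c).symm⟩
    · rintro ι _ ⟨c, rfl⟩
      exact ⟨_, (actA φ hφ (⟨g, hg⟩ : A.stab p)⁻¹ ι c).symm⟩
  · intro g hg
    refine CubeComplex.Subcomplex.mem_stab_of_forall ?_ ?_
    · rintro ι _ ⟨c, rfl⟩
      exact ⟨_, (actB φ hφ ⟨g, hg⟩ ι c).symm⟩
    · rintro ι _ ⟨c, rfl⟩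
      exact ⟨_, (actB φ hφ (⟨g, hg⟩ : B.stab p)⁻¹ ι c).symm⟩
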